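/- Let $(\Omega,\mathcal F_\infty,\mathbb P)$ be a probability space with a filtration $(\mathcal F_t)_{t\in\{0,1,2,\dots\}}$, and let $P=(P_t)_{t\ge 0}$ be an $\mathbb R^n$-valued adapted process (asset prices, of arbitrary sign; no numéraire is assumed to exist). A *martingale deflator* is an almost surely strictly positive real adapted process $Y=(Y_t)_{t\ge0}$ such that $(Y_tP_t)_{t\ge0}$ is a martingale. A *pure-investment strategy* is an $\mathbb R^n$-valued predictable process $H$ ($H_t$ is $\mathcal F_{t-1}$-measurable for $t\ge1$), with the convention $H_0=H_1$, such that $(H_t-H_{t+1})\cdot P_t=0$ almost surely for all $t\ge1$. Assume that at least one martingale deflator exists. (i) Let $\xi=(\xi_t)_{t\ge 0}$ be a real adapted process such that $\xi Y$ is a martingale for every martingale deflator $Y$ for which $\xi_tY_t$ is integrable for all $t\ge0$. Then there is a pure-investment strategy $H$ such that $H_t\cdot P_t=\xi_t$ almost surely for all $t\ge0$. (ii) Let $T\ge1$ be an integer, let $\xi_T$ be a real $\mathcal F_T$-measurable random variable, and suppose that there is a constant $\xi_0\in\mathbb R$ such that $\mathbb E(\xi_TY_T)=\xi_0Y_0$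 almost surely for every martingale deflator $Y$ for which $\xi_TY_T$ is integrable. Then there is a pure-investment strategy $H$ such that $H_T\cdot P_T=\xi_T$ almost surely. -/

import Mathlib

open MeasureTheory

/-- A martingale deflator for the price process `P`: a strictly positive adapted real process `Y`
such that the `n`-dimensional process `(Y_t P_t)` is a (true) martingale on the infinite horizon. -/
structure IsMartingaleDeflator {Ω : Type*} {m : MeasurableSpace Ω} {n : ℕ}
    (ℱ : Filtration ℕ m) (μ : Measure Ω) (P : ℕ → Ω → (Fin n → ℝ)) (Y : ℕ → Ω → ℝ) : Prop where
  adapted : StronglyAdapted ℱ Y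
  pos : ∀ t, ∀ᵐ ω ∂μ, 0 < Y t ω
  martingale : Martingale (fun t ω => Y t ω • P t ω) ℱ μ

/-- An investment-consumption strategy: a predictable process `H` (so that `H (t + 1)` is
`ℱ t`-measurable) satisfying the self-financing condition with free disposal. -/
structure IsInvestmentConsumptionStrategy {Ω : Type*} {m : MeasurableSpace Ω} {n : ℕ}
    (ℱ : Filtration ℕ m) (μ : Measure Ω) (P H : ℕ → Ω → (Fin n → ℝ)) : Prop where
  predictable : IsStronglyPredictable ℱ H
  selfFinancing : ∀ t, 1 ≤ t → ∀ᵐ ω ∂μ, H (t + 1) ω ⬝ᵥ P t ω ≤ H t ω ⬝ᵥ P t ω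

/-- A pure-investment strategy: nothing is consumed at times `t ≥ 1`, with the convention
`H 0 = H 1`. -/
structure IsPureInvestmentStrategy {Ω : Type*} {m : MeasurableSpace Ω} {n : ℕ}
    (ℱ : Filtration ℕ m) (μ : Measure Ω) (P H : ℕ → Ω → (Fin n → ℝ)) : Prop
    extends IsInvestmentConsumptionStrategy ℱ μ P H where
  noConsumption : ∀ t, 1 ≤ t → ∀ᵐ ω ∂μ, (H t ω - H (t + 1) ω) ⬝ᵥ P t ω = 0
  initial : H 0 = H 1

/-! Replication is a conditional duality argument. Fix a deflator `Y` that makes the deflated claim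
integrable, and let `h` be `ℱ (t + 1)`-measurable, `|h| ≤ 1/2`, with the conditional mean of `h Y (t
+ 1) P (t + 1)` given `ℱ t` equal to zero. Multiplying `Y` by `1 + h` from time `t + 1` on gives
another deflator, so the hypothesis on the claim forces `∫ h W = 0`, where `W` is the deflated value
at `t + 1`. Hence `W` is a combination of the coordinates of `Y (t + 1) P (t + 1)` with `ℱ
t`-measurable coefficients (`exists_eq_sum_mul_of_orthogonal`). These are the portfolio;
conditioning on `ℱ t` gives its value at `t`, so consecutive portfolios match and no consumption
occurs.

The coefficients come from weighted conditional normal equations. The Gram matrix may be singular,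
so a Borel generalized inverse is used, and weights supply the missing integrability.

The remaining difficulty is that a deflator making the claim integrable must exist. A variable known
at time `T` is made bounded by working backwards: each period's factor, near `1` and preserving the
conditional mean of the deflated prices, replaces the bound by one known a period earlier. Doing
this for the value at every time with summable errors, and taking the infinite product, handles a
whole process. -/

/-! ### Measurable generalized inverses. -/

/-- In an eigenbasis `d / (d + δ)^2` tends to `1 / d` for `d > 0` and is `0` for `d = 0`. The
pseudo-inverse is thus a pointwise limit of rational expressions in the entries, which gives
measurability. -/
theorem Matrix.posSemidef_tendsto_pinv {n : ℕ} {N : Matrix (Fin n) (Fin n) ℝ} (hN : N.PosSemidef) :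
    ∃ C : Matrix (Fin n) (Fin n) ℝ, N * C * N = N ∧
      Filter.Tendsto (fun k : ℕ => ((N + ((k : ℝ) + 1)⁻¹ • 1)⁻¹) ^ 2 * N) Filter.atTop (nhds C) := by
  have hH := hN.1
  set U : Matrix (Fin n) (Fin n) ℝ := hH.eigenvectorUnitary.1 with hU
  set d := hH.eigenvalues with hd
  have h1 : star U * U = 1 := Unitary.coe_star_mul_self hH.eigenvectorUnitary
  have h2 : U * star U = 1 := Unitary.coe_mul_star_self hH.eigenvectorUnitary
  have hNe : N = U * Matrix.diagonal d * star U := by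
    have := hH.spectral_theorem
    simpa [Unitary.conjStarAlgAut_apply] using this
  have hd0 : ∀ i, 0 ≤ d i := hN.eigenvalues_nonneg
  have mulU : ∀ a b : Fin n → ℝ, (U * Matrix.diagonal a * star U) * (U * Matrix.diagonal b * star U)
      = U * Matrix.diagonal (fun i => a i * b i) * star U := by
    intro a b
    calc _ = U * Matrix.diagonal a * (star U * U) * Matrix.diagonal b * star U := by
          simp only [Matrix.mul_assoc]
      _ = _ := by rw [h1, Matrix.mul_one, Matrix.mul_assoc U, Matrix.diagonal_mul_diagonal]
  -- The convention `0⁻¹ = 0` makes this the pseudo-inverse on the kernel as well.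
  refine ⟨U * Matrix.diagonal (fun i => (d i)⁻¹) * star U, ?_, ?_⟩
  · rw [hNe, mulU, mulU]
    congr 3
    ext i
    exact mul_inv_mul_cancel _
  · have key : ∀ k : ℕ, ((N + ((k : ℝ) + 1)⁻¹ • 1)⁻¹) ^ 2 * N
        = U * Matrix.diagonal (fun i => ((d i + ((k : ℝ) + 1)⁻¹)⁻¹) ^ 2 * d i) * star U := by
      intro k
      have hk : (0 : ℝ) < ((k : ℝ) + 1)⁻¹ := by positivity
      have hs : N + ((k : ℝ) + 1)⁻¹ • 1
          = U * Matrix.diagonal (fun i => d i + ((k : ℝ) + 1)⁻¹) * star U := by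
        have : Matrix.diagonal (fun i => d i + ((k : ℝ) + 1)⁻¹)
            = Matrix.diagonal d + ((k : ℝ) + 1)⁻¹ • (1 : Matrix (Fin n) (Fin n) ℝ) := by
          ext i j
          by_cases h : i = j <;> simp [h]
        rw [this, Matrix.mul_add, Matrix.add_mul, ← hNe]
        simp [h2]
      have hinv : (N + ((k : ℝ) + 1)⁻¹ • 1)⁻¹
          = U * Matrix.diagonal (fun i => (d i + ((k : ℝ) + 1)⁻¹)⁻¹) * star U := by
        apply Matrix.inv_eq_left_inv
        rw [hs, mulU]
        have : (fun i => (d i + ((k : ℝ) + 1)⁻¹)⁻¹ * (d i + ((k : ℝ) + 1)⁻¹)) = fun _ => 1 := by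
          ext i
          have := hd0 i
          field_simp
        rw [this, Matrix.diagonal_one, Matrix.mul_one, h2]
      rw [hinv, pow_two, mulU]
      conv_lhs => rw [hNe]
      rw [mulU]
      simp only [pow_two]
    simp only [key]
    refine ((Filter.Tendsto.const_mul U ?_).mul_const (star U))
    refine (continuous_id.matrix_diagonal.tendsto _).comp (tendsto_pi_nhds.2 fun i => ?_)
    have hlim : Filter.Tendsto (fun k : ℕ => ((k : ℝ) + 1)⁻¹) Filter.atTop (nhds 0) := by
      simpa using tendsto_one_div_add_atTop_nhds_zero_nat (𝕜 := ℝ)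
    rcases eq_or_lt_of_le (hd0 i) with h | h
    · simp [← h]
    · have : Filter.Tendsto (fun k : ℕ => ((d i + ((k : ℝ) + 1)⁻¹)⁻¹) ^ 2 * d i) Filter.atTop
          (nhds (((d i + 0)⁻¹) ^ 2 * d i)) :=
        (((hlim.const_add (d i)).inv₀ (by simpa using h.ne')).pow 2).mul_const _
      convert this using 2
      field_simp
      simp

/-- A Borel measurable choice of generalized inverse for real square matrices. -/
theorem Matrix.exists_measurable_generalizedInverse (n : ℕ) :
    ∃ g : Matrix (Fin n) (Fin n) ℝ → Matrix (Fin n) (Fin n) ℝ,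
      (∀ {Ω : Type _} (_ : MeasurableSpace Ω) (A : Ω → Matrix (Fin n) (Fin n) ℝ),
        (∀ i j, Measurable fun ω => A ω i j) → ∀ i j, Measurable fun ω => g (A ω) i j) ∧
      ∀ A, A * g A * A = A := by
  have hex : ∀ A : Matrix (Fin n) (Fin n) ℝ, (A.transpose * A).PosSemidef := fun A => by
    simpa using Matrix.posSemidef_conjTranspose_mul_self A
  choose C hC hlim using fun A => Matrix.posSemidef_tendsto_pinv (hex A)
  refine ⟨fun A => C A * A.transpose, ?_, ?_⟩
  · intro Ω m A hA i j
    have hmul : ∀ {S T : Ω → Matrix (Fin n) (Fin n) ℝ}, (∀ i j, Measurable fun ω => S ω i j) →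
        (∀ i j, Measurable fun ω => T ω i j) → ∀ i j, Measurable fun ω => (S ω * T ω) i j := by
      intro S T hS hT i j
      simp only [Matrix.mul_apply]
      exact Finset.measurable_sum _ fun l _ => (hS i l).mul (hT l j)
    have hinv : ∀ {S : Ω → Matrix (Fin n) (Fin n) ℝ}, (∀ i j, Measurable fun ω => S ω i j) →
        ∀ i j, Measurable fun ω => (S ω)⁻¹ i j := by
      intro S hS i j
      have hc : Measurable fun ω => (fun i j => S ω i j : Fin n → Fin n → ℝ) :=
        measurable_pi_lambda _ fun i => measurable_pi_lambda _ fun j => hS i j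
      have hdet : Measurable fun ω => (S ω).det := by
        have : Continuous fun T : Fin n → Fin n → ℝ => (Matrix.of T).det :=
          Continuous.matrix_det continuous_id
        exact this.measurable.comp hc
      have hadj : Measurable fun ω => (S ω).adjugate i j := by
        have : Continuous fun T : Fin n → Fin n → ℝ => (Matrix.of T).adjugate i j :=
          (Continuous.matrix_adjugate continuous_id).matrix_elem i j
        exact this.measurable.comp hc
      simp only [Matrix.inv_def, Matrix.smul_apply, Ring.inverse_eq_inv', smul_eq_mul]
      exact hdet.inv.mul hadj
    have hAt : ∀ i j, Measurable fun ω => (A ω).transpose i j := fun i j => hA j i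
    refine hmul (S := fun ω => C (A ω)) (fun i j => ?_) hAt i j
    refine measurable_of_tendsto_metrizable (f := fun (k : ℕ) ω =>
      (((((A ω).transpose * A ω) + ((k : ℝ) + 1)⁻¹ • 1)⁻¹) ^ 2 * ((A ω).transpose * A ω)) i j)
      (fun k => ?_) ?_
    · simp only [pow_two]
      have hI := hinv (S := fun ω => (A ω).transpose * A ω + ((k : ℝ) + 1)⁻¹ • 1) (fun i j => by
        simp only [Matrix.add_apply]
        exact (hmul hAt hA i j).add_const _)
      exact hmul (hmul hI hI) (hmul hAt hA) i j
    · rw [tendsto_pi_nhds]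
      intro ω
      exact ((continuous_id.matrix_elem i j).tendsto (C (A ω))).comp (hlim (A ω))
  · intro A
    have h := hC A
    -- `Aᵀ A Z = 0` implies `A Z = 0`, which cancels the left factor `Aᵀ`.
    have h0 : A.conjTranspose * A * (C A * A.transpose * A - 1) = 0 := by
      rw [Matrix.mul_sub, Matrix.mul_one, sub_eq_zero]
      simpa [Matrix.mul_assoc] using h
    rw [Matrix.conjTranspose_mul_self_mul_eq_zero, Matrix.mul_sub, Matrix.mul_one,
      sub_eq_zero] at h0
    simpa [Matrix.mul_assoc] using h0

/-! ### Conditional normal equations. -/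

/-- Pulling bounded measurable coefficients out of the conditional expectation of a finite sum. -/
theorem MeasureTheory.condExp_sum_mul_of_bound {Ω ι : Type*} {G m : MeasurableSpace Ω}
    {μ : Measure Ω} [IsFiniteMeasure μ] (hG : G ≤ m) (s : Finset ι) {w f : ι → Ω → ℝ} {C : ℝ}
    (hw : ∀ i, Measurable[G] (w i)) (hwC : ∀ i ω, |w i ω| ≤ C) (hf : ∀ i, Integrable (f i) μ) :
    Integrable (fun ω => ∑ i ∈ s, w i ω * f i ω) μ ∧
    μ[fun ω => ∑ i ∈ s, w i ω * f i ω|G] =ᵐ[μ] fun ω => ∑ i ∈ s, w i ω * (μ[f i|G]) ω := by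
  have hint : ∀ i, Integrable (fun ω => w i ω * f i ω) μ := fun i =>
    (hf i).bdd_mul ((hw i).mono hG le_rfl).aestronglyMeasurable (ae_of_all _ (hwC i))
  refine ⟨integrable_finsetSum s fun i _ => hint i, ?_⟩
  have h1 := condExp_finsetSum (μ := μ) (s := s) (f := fun i ω => w i ω * f i ω)
    (fun i _ => hint i) G
  have h2 : ∀ᵐ ω ∂μ, ∀ i ∈ s, (μ[fun ω => w i ω * f i ω|G]) ω = w i ω * (μ[f i|G]) ω := by
    rw [Finset.eventually_all]
    intro i _
    exact condExp_stronglyMeasurable_mul_of_bound hG (hw i).stronglyMeasurable (hf i) C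
      (ae_of_all _ (hwC i))
  have h3 : (∑ i ∈ s, fun ω => w i ω * f i ω) = fun ω => ∑ i ∈ s, w i ω * f i ω := by
    ext ω; simp
  rw [h3] at h1
  filter_upwards [h1, h2] with ω h1 h2
  rw [h1, Finset.sum_apply]
  exact Finset.sum_congr rfl fun i hi => h2 i hi

theorem MeasureTheory.condExp_mul_of_bound {Ω : Type*} {G m : MeasurableSpace Ω}
    {μ : Measure Ω} [IsFiniteMeasure μ] (hG : G ≤ m) {w f : Ω → ℝ} {C : ℝ}
    (hw : Measurable[G] w) (hwC : ∀ ω, |w ω| ≤ C) (hf : Integrable f μ) :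
    Integrable (fun ω => w ω * f ω) μ ∧
    μ[fun ω => w ω * f ω|G] =ᵐ[μ] fun ω => w ω * (μ[f|G]) ω :=
  ⟨hf.bdd_mul (hw.mono hG le_rfl).aestronglyMeasurable (ae_of_all _ hwC),
    condExp_stronglyMeasurable_mul_of_bound hG hw.stronglyMeasurable hf C (ae_of_all _ hwC)⟩

theorem abs_div_one_add_sum_abs_le_one {ι : Type*} [Fintype ι] (v : ι → ℝ) (j : ι) :
    |(1 + ∑ k, |v k|)⁻¹ * v j| ≤ 1 := by
  have h0 : 0 ≤ ∑ k, |v k| := Finset.sum_nonneg fun k _ => abs_nonneg _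
  have h1 : |v j| ≤ ∑ k, |v k| :=
    Finset.single_le_sum (f := fun k => |v k|) (fun k _ => abs_nonneg _) (Finset.mem_univ j)
  rw [abs_mul, abs_of_nonneg (by positivity : 0 ≤ (1 + ∑ k, |v k|)⁻¹), inv_mul_le_iff₀ (by positivity)]
  linarith

/-- Solvability of the conditional normal equations: the conditional Gram matrix of `X` with
weight `ψ` has a measurable generalized inverse `B`, and `B` inverts it on the vectors of
conditional moments of `X`. -/
theorem MeasureTheory.exists_condExp_gram_inverse {Ω : Type*} {G m : MeasurableSpace Ω}
    {μ : Measure Ω} [IsFiniteMeasure μ] (hG : G ≤ m) {n : ℕ} {X : Ω → Fin n → ℝ} {ψ : Ω → ℝ}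
    (hψ : ∀ ω, 0 < ψ ω) (hX : ∀ i j, Integrable (fun ω => ψ ω * X ω i * X ω j) μ) :
    ∃ B : Ω → Matrix (Fin n) (Fin n) ℝ, (∀ i j, Measurable[G] fun ω => B ω i j) ∧
      ∀ φ : Ω → ℝ, (∀ i, Integrable (fun ω => φ ω * X ω i) μ) → ∀ i, ∀ᵐ ω ∂μ,
        ∑ j, (μ[fun ω => ψ ω * X ω i * X ω j|G]) ω *
          (∑ k, B ω j k * (μ[fun ω => φ ω * X ω k|G]) ω) = (μ[fun ω => φ ω * X ω i|G]) ω := by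
  obtain ⟨g, hgm, hg⟩ := Matrix.exists_measurable_generalizedInverse n
  set M : Ω → Matrix (Fin n) (Fin n) ℝ :=
    fun ω => Matrix.of fun i j => (μ[fun ω => ψ ω * X ω i * X ω j|G]) ω with hM
  have hMm : ∀ i j, Measurable[G] fun ω => M ω i j := fun i j =>
    stronglyMeasurable_condExp.measurable
  have hBm : ∀ i j, Measurable[G] fun ω => g (M ω) i j := hgm G M hMm
  refine ⟨fun ω => g (M ω), hBm, fun φ hφ i => ?_⟩
  -- The row `v` annihilates `M` from the left, so the `ψ`-weighted conditional second moment of `v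
  -- · X` vanishes and `v · X = 0` almost surely. Then `v` also annihilates the moment vector of `φ
  -- X`, which is the claim.
  set v : Fin n → Ω → ℝ := fun j ω => (1 - M ω * g (M ω)) i j with hv
  have hvm : ∀ j, Measurable[G] (v j) := by
    intro j
    simp only [hv, Matrix.sub_apply, Matrix.mul_apply]
    exact measurable_const.sub (Finset.measurable_sum _ fun l _ => (hMm i l).mul (hBm l j))
  have hvM : ∀ ω k, ∑ j, v j ω * M ω j k = 0 := by
    intro ω k
    have : ((1 - M ω * g (M ω)) * M ω) i k = 0 := by
      rw [Matrix.sub_mul, hg, Matrix.one_mul, sub_self]; rfl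
    rwa [Matrix.mul_apply] at this
  -- Normalizing makes the coefficients bounded, so they can be pulled out of conditional
  -- expectations.
  set c : Ω → ℝ := fun ω => (1 + ∑ k, |v k ω|)⁻¹ with hc
  have hcpos : ∀ ω, 0 < c ω := fun ω => by
    have : 0 ≤ ∑ k, |v k ω| := Finset.sum_nonneg fun k _ => abs_nonneg _
    simp only [hc]; positivity
  have hcm : Measurable[G] c := by
    have : Measurable[G] fun ω => ∑ k, |v k ω| :=
      Finset.measurable_sum _ fun k _ => measurable_norm.comp (hvm k)
    exact (this.const_add 1).inv
  set w : Fin n → Ω → ℝ := fun j ω => c ω * v j ω with hw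
  have hwm : ∀ j, Measurable[G] (w j) := fun j => hcm.mul (hvm j)
  have hw1 : ∀ j ω, |w j ω| ≤ 1 := fun j ω => abs_div_one_add_sum_abs_le_one (fun k => v k ω) j
  have hS := condExp_sum_mul_of_bound (μ := μ) hG (Finset.univ : Finset (Fin n × Fin n))
    (w := fun p ω => w p.1 ω * w p.2 ω) (f := fun p ω => ψ ω * X ω p.1 * X ω p.2) (C := 1)
    (fun p => (hwm p.1).mul (hwm p.2))
    (fun p ω => by rw [abs_mul]; exact mul_le_one₀ (hw1 _ _) (abs_nonneg _) (hw1 _ _))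
    (fun p => hX p.1 p.2)
  have hsq : (fun ω => ∑ p : Fin n × Fin n, w p.1 ω * w p.2 ω * (ψ ω * X ω p.1 * X ω p.2))
      = fun ω => ψ ω * (∑ j, w j ω * X ω j) ^ 2 := by
    ext ω
    rw [pow_two, Finset.sum_mul_sum, Fintype.sum_prod_type, Finset.mul_sum]
    refine Finset.sum_congr rfl fun j _ => ?_
    rw [Finset.mul_sum]
    exact Finset.sum_congr rfl fun k _ => by ring
  rw [hsq] at hS
  have hzero : ∀ ω, ∑ p : Fin n × Fin n, w p.1 ω * w p.2 ω * M ω p.1 p.2 = 0 := by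
    intro ω
    rw [Fintype.sum_prod_type, Finset.sum_comm]
    refine Finset.sum_eq_zero fun k _ => ?_
    have : ∑ j, w j ω * w k ω * M ω j k = c ω * w k ω * ∑ j, v j ω * M ω j k := by
      rw [Finset.mul_sum]
      exact Finset.sum_congr rfl fun j _ => by simp only [hw]; ring
    rw [this, hvM, mul_zero]
  have hint0 : ∫ ω, ψ ω * (∑ j, w j ω * X ω j) ^ 2 ∂μ = 0 := by
    rw [← integral_condExp hG, integral_congr_ae hS.2]
    exact (integral_congr_ae (ae_of_all _ hzero)).trans (by simp)
  rw [integral_eq_zero_iff_of_nonneg (fun ω => mul_nonneg (hψ ω).le (sq_nonneg _)) hS.1] at hint0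
  have hwX : ∀ᵐ ω ∂μ, ∑ j, w j ω * (φ ω * X ω j) = 0 := by
    filter_upwards [hint0] with ω h
    have h' : ∑ j, w j ω * X ω j = 0 := by
      have h := mul_eq_zero.1 h
      simpa [(hψ ω).ne'] using h
    calc _ = φ ω * ∑ j, w j ω * X ω j := by
          rw [Finset.mul_sum]; exact Finset.sum_congr rfl fun j _ => by ring
      _ = 0 := by rw [h', mul_zero]
  have hE := (condExp_sum_mul_of_bound (μ := μ) hG Finset.univ hwm hw1 hφ).2
  have hE0 : μ[fun ω => ∑ j, w j ω * (φ ω * X ω j)|G] =ᵐ[μ] 0 := by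
    refine (condExp_congr_ae (g := 0) hwX).trans ?_
    rw [condExp_zero]
  filter_upwards [hE, hE0] with ω h1 h2
  rw [h1, Pi.zero_apply] at h2
  set e : Fin n → ℝ := fun k => (μ[fun ω => φ ω * X ω k|G]) ω with he
  have h3 : c ω * ((1 - M ω * g (M ω)).mulVec e i) = 0 := by
    rw [← h2, Matrix.mulVec, dotProduct, Finset.mul_sum]
    exact Finset.sum_congr rfl fun j _ => by simp only [hw, hv, he]; ring
  have h4 := (mul_eq_zero.1 h3).resolve_left (hcpos ω).ne'
  rw [Matrix.sub_mulVec, Matrix.one_mulVec, ← Matrix.mulVec_mulVec, Pi.sub_apply, sub_eq_zero] at h4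
  exact h4.symm

/-! ### Cut-offs at a conditionally deterministic level. -/

theorem MeasureTheory.exists_nat_measure_lt_le {Ω : Type*} {m : MeasurableSpace Ω}
    {μ : Measure Ω} [IsFiniteMeasure μ] {D : Ω → ℝ} (hD : Measurable D) {ε : ℝ} (hε : 0 < ε) :
    ∃ k : ℕ, μ {ω | (k : ℝ) < D ω} ≤ ENNReal.ofReal ε := by
  have h : Filter.Tendsto (fun k : ℕ => μ {ω | (k : ℝ) < D ω}) Filter.atTop
      (nhds (μ (⋂ k : ℕ, {ω | (k : ℝ) < D ω}))) := by
    refine tendsto_measure_iInter_atTop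
      (fun k => (measurableSet_lt measurable_const hD).nullMeasurableSet) ?_ ⟨0, measure_ne_top _ _⟩
    intro a b hab ω (hω : (b : ℝ) < D ω)
    exact lt_of_le_of_lt (Nat.cast_le.2 hab) hω
  have h0 : (⋂ k : ℕ, {ω | (k : ℝ) < D ω}) = ∅ := by
    refine Set.eq_empty_of_forall_notMem fun ω hω => ?_
    obtain ⟨k, hk⟩ := exists_nat_gt (D ω)
    exact absurd (Set.mem_iInter.1 hω k) (not_lt.2 hk.le)
  rw [h0, measure_empty] at h
  exact (h.eventually_le_const (ENNReal.ofReal_pos.2 hε)).exists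

/-- A cut-off `q ≤ 1` of the weight `1 + D` at a conditionally deterministic level `N`, such that
the conditional mass of `R` that is cut away is small relative to a given weight `c`. -/
theorem MeasureTheory.exists_condExp_cutoff {Ω : Type*} {G F m : MeasurableSpace Ω}
    {μ : Measure Ω} [IsFiniteMeasure μ] (hGF : G ≤ F) (hF : F ≤ m) {D R c : Ω → ℝ}
    (hD : Measurable[F] D) (hD0 : ∀ ω, 0 ≤ D ω) (hR : Integrable R μ)
    (hc : Measurable[G] c) {ε : ℝ} (hε : 0 < ε) :
    ∃ q N : Ω → ℝ, Measurable[F] q ∧ Measurable[G] N ∧ (∀ ω, (1 + D ω)⁻¹ ≤ q ω) ∧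
      (∀ ω, q ω ≤ 1) ∧ (∀ ω, q ω * (1 + D ω) ≤ N ω) ∧ μ {ω | q ω < 1} ≤ ENNReal.ofReal ε ∧
      ∀ᵐ ω ∂μ, c ω * (μ[fun ω => (1 - q ω) * R ω|G]) ω ≤ ε := by
  have hG : G ≤ m := hGF.trans hF
  set Q : ℕ → Ω → ℝ := fun k ω => min 1 (((k : ℝ) + 1) / (1 + D ω)) with hQ
  have hQm : ∀ k, Measurable[F] (Q k) := fun k =>
    Measurable.min measurable_const (Measurable.div measurable_const (Measurable.const_add hD 1))
  have hDpos : ∀ ω, 0 < 1 + D ω := fun ω => by linarith [hD0 ω]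
  have hQ0 : ∀ k ω, 0 ≤ Q k ω := fun k ω => le_min zero_le_one (div_nonneg (by positivity) (hDpos ω).le)
  have hQ1 : ∀ k ω, Q k ω ≤ 1 := fun k ω => min_le_left _ _
  have hbd : ∀ k ω, |1 - Q k ω| ≤ 1 := fun k ω => by
    rw [abs_le]; constructor <;> linarith [hQ0 k ω, hQ1 k ω]
  have hint : ∀ k, Integrable (fun ω => (1 - Q k ω) * R ω) μ := fun k =>
    hR.bdd_mul (((hQm k).mono hF le_rfl).const_sub 1).aestronglyMeasurable
      (ae_of_all _ (hbd k))
  -- almost sure convergence to zero along a subsequence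
  have hL : Filter.Tendsto (fun k => condExpL1 hG μ (fun ω => (1 - Q k ω) * R ω)) Filter.atTop
      (nhds (condExpL1 hG μ (fun _ => (0 : ℝ)))) := by
    refine tendsto_condExpL1_of_dominated_convergence hG (fun ω => |R ω|) (fun k => (hint k).1)
      hR.abs (fun k => ae_of_all _ fun ω => ?_) (ae_of_all _ fun ω => ?_)
    · rw [Real.norm_eq_abs, abs_mul]
      exact mul_le_of_le_one_left (abs_nonneg _) (hbd k ω)
    · refine tendsto_const_nhds.congr' ?_
      obtain ⟨k, hk⟩ := exists_nat_gt (D ω)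
      filter_upwards [Filter.eventually_ge_atTop k] with j hj
      have : Q j ω = 1 := by
        refine min_eq_left ?_
        rw [le_div_iff₀ (hDpos ω)]
        have : (k : ℝ) ≤ j := Nat.cast_le.2 hj
        linarith
      simp [this]
  obtain ⟨φ, hφ, hφlim⟩ := (tendstoInMeasure_of_tendsto_Lp hL).exists_seq_tendsto_ae
  set r : ℕ → Ω → ℝ := fun k => μ[fun ω => (1 - Q k ω) * R ω|G] with hr
  have hrm : ∀ k, Measurable[G] (r k) := fun k => stronglyMeasurable_condExp.measurable
  have hrlim : ∀ᵐ ω ∂μ, Filter.Tendsto (fun j => r (φ j) ω) Filter.atTop (nhds 0) := by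
    have h1 : ∀ᵐ ω ∂μ, ∀ k, r k ω = condExpL1 hG μ (fun ω => (1 - Q k ω) * R ω) ω :=
      ae_all_iff.2 fun k => condExp_ae_eq_condExpL1 hG _
    have h2 : μ[fun _ => (0 : ℝ)|G] =ᵐ[μ] condExpL1 hG μ (fun _ => (0 : ℝ)) :=
      condExp_ae_eq_condExpL1 hG _
    filter_upwards [h1, h2, hφlim] with ω h1 h2 h3
    rw [← h2] at h3
    have h0 : (μ[fun _ => (0 : ℝ)|G]) ω = 0 := by
      have := condExp_zero (m := G) (μ := μ) (E := ℝ)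
      exact congrFun this ω
    rw [h0] at h3
    simpa only [h1] using h3
  obtain ⟨k₀, hk₀⟩ := exists_nat_measure_lt_le (μ := μ) (hD.mono hF le_rfl) hε
  -- The level is the first index from `k₀` on that meets the bound. The second alternative supplies
  -- the default `k₀` where there is none, a null event, so that `Nat.find` is defined everywhere.
  set p : Ω → ℕ → Prop := fun ω k =>
    k₀ ≤ k ∧ (c ω * r k ω ≤ ε ∨ ¬ ∃ j, k₀ ≤ j ∧ c ω * r j ω ≤ ε) with hp
  have hpex : ∀ ω, ∃ k, p ω k := by
    intro ω
    by_cases h : ∃ j, k₀ ≤ j ∧ c ω * r j ω ≤ ε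
    · obtain ⟨j, hj, hj'⟩ := h
      exact ⟨j, hj, Or.inl hj'⟩
    · exact ⟨k₀, le_rfl, Or.inr h⟩
  have hset : ∀ k, MeasurableSet[G] {ω | c ω * r k ω ≤ ε} := fun k =>
    (Measurable.mul hc (hrm k)) measurableSet_Iic
  have hpm : ∀ k, MeasurableSet[G] {ω | p ω k} := by
    intro k
    have h1 : {ω | ∃ j, k₀ ≤ j ∧ c ω * r j ω ≤ ε}
        = ⋃ j, ⋃ (_ : k₀ ≤ j), {ω | c ω * r j ω ≤ ε} := by
      ext ω; simp
    have h2 : MeasurableSet[G] {ω | ∃ j, k₀ ≤ j ∧ c ω * r j ω ≤ ε} := by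
      rw [h1]
      exact MeasurableSet.iUnion fun j => MeasurableSet.iUnion fun _ => hset j
    exact (MeasurableSet.const (k₀ ≤ k)).inter ((hset k).union h2.compl)
  classical
  set K : Ω → ℕ := fun ω => Nat.find (hpex ω) with hK
  have hKm : Measurable[G] K := @measurable_find _ G _ _ hpex hpm
  have hKp : ∀ ω, p ω (K ω) := fun ω => Nat.find_spec (hpex ω)
  have hNm : Measurable[G] fun ω => (K ω : ℝ) + 1 :=
    Measurable.add_const (measurable_from_nat.comp hKm) 1
  refine ⟨fun ω => Q (K ω) ω, fun ω => (K ω : ℝ) + 1, ?_, hNm, fun ω => ?_, fun ω => hQ1 _ _,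
    fun ω => ?_, ?_, ?_⟩
  · exact Measurable.min measurable_const
      (Measurable.div (hNm.mono hGF le_rfl) (Measurable.const_add hD 1))
  · have h1 := inv_le_one_of_one_le₀ (by linarith [hD0 ω] : 1 ≤ 1 + D ω)
    refine le_min h1 ?_
    rw [inv_eq_one_div]
    exact div_le_div_of_nonneg_right (by linarith [Nat.cast_nonneg (α := ℝ) (K ω)]) (hDpos ω).le
  · rw [← le_div_iff₀ (hDpos ω)]
    exact min_le_right _ _
  · refine (measure_mono ?_).trans hk₀
    intro ω (hω : Q (K ω) ω < 1)
    by_contra hcon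
    rw [Set.mem_ofPred_eq, not_lt] at hcon
    refine hω.ne (min_eq_left ?_)
    rw [le_div_iff₀ (hDpos ω)]
    have : (k₀ : ℝ) ≤ K ω := Nat.cast_le.2 (hKp ω).1
    linarith
  · have hqint : Integrable (fun ω => (1 - Q (K ω) ω) * R ω) μ := by
      refine hR.bdd_mul (c := 1) ?_ (ae_of_all _ fun ω => hbd (K ω) ω)
      have : Measurable[F] fun ω => Q (K ω) ω := Measurable.min measurable_const
        (Measurable.div (hNm.mono hGF le_rfl) (Measurable.const_add hD 1))
      exact ((this.mono hF le_rfl).const_sub 1).aestronglyMeasurable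
    -- Conditional expectation is local on the `G`-events `{K = k}`, so the random level may be
    -- treated as a constant there.
    have hloc : ∀ᵐ ω ∂μ, ∀ k, K ω = k → (μ[fun ω => (1 - Q (K ω) ω) * R ω|G]) ω = r k ω := by
      rw [ae_all_iff]
      intro k
      have hs : MeasurableSet[G] {ω | K ω = k} := hKm (measurableSet_singleton k)
      have e1 := condExp_indicator hqint hs
      have e2 := condExp_indicator (hint k) hs
      have e3 : {ω | K ω = k}.indicator (fun ω => (1 - Q (K ω) ω) * R ω)
          = {ω | K ω = k}.indicator (fun ω => (1 - Q k ω) * R ω) := by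
        refine Set.indicator_congr fun ω (hω : K ω = k) => ?_
        simp only [hω]
      rw [e3] at e1
      filter_upwards [e1, e2] with ω e1 e2 hω
      have e4 := e1.symm.trans e2
      rwa [Set.indicator_of_mem (by exact hω), Set.indicator_of_mem (by exact hω)] at e4
    filter_upwards [hloc, hrlim] with ω h1 h2
    rw [h1 _ rfl]
    have h3 : Filter.Tendsto (fun j => c ω * r (φ j) ω) Filter.atTop (nhds 0) := by
      simpa using h2.const_mul (c ω)
    obtain ⟨j, hj1, hj2⟩ := ((h3.eventually_le_const hε).and
      (hφ.tendsto_atTop.eventually_ge_atTop k₀)).exists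
    exact (hKp ω).2.resolve_right fun h => h ⟨φ j, hj2, hj1⟩

theorem MeasureTheory.ae_abs_condExp_le {Ω : Type*} {G m : MeasurableSpace Ω} {μ : Measure Ω}
    {f g : Ω → ℝ} (hf : Integrable f μ) (hg : Integrable g μ) (h : ∀ ω, |f ω| ≤ g ω) :
    ∀ᵐ ω ∂μ, |(μ[f|G]) ω| ≤ (μ[g|G]) ω := by
  filter_upwards [condExp_mono (m := G) hf hg (ae_of_all _ fun ω => (abs_le.1 (h ω)).2),
    condExp_mono (m := G) hg.neg hf (ae_of_all _ fun ω => (abs_le.1 (h ω)).1),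
    condExp_neg (μ := μ) g G] with ω h1 h2 h3
  rw [h3] at h2
  exact abs_le.2 ⟨h2, h1⟩

/-! ### Weights supplying integrability. -/

section Weight

variable {n : ℕ} (X : Fin n → ℝ) {D : ℝ}

/-- A positive weight making products of two of the numbers `X i`, `D` bounded. -/
noncomputable def quadraticWeight (D : ℝ) : ℝ := ((1 + D) * (1 + ∑ i, |X i|) ^ 2)⁻¹

variable {X}

theorem one_le_one_add_sum_abs : 1 ≤ 1 + ∑ i, |X i| :=
  le_add_of_nonneg_right (Finset.sum_nonneg fun _ _ => abs_nonneg _)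

theorem abs_le_one_add_sum_abs (i : Fin n) : |X i| ≤ 1 + ∑ k, |X k| :=
  (Finset.single_le_sum (f := fun k => |X k|) (fun k _ => abs_nonneg _) (Finset.mem_univ i)).trans
    (by linarith)

theorem quadraticWeight_pos (hD : 0 ≤ D) : 0 < quadraticWeight X D := by
  have := one_le_one_add_sum_abs (X := X)
  unfold quadraticWeight
  positivity

theorem abs_quadraticWeight_mul_mul_le (hD : 0 ≤ D) (i j : Fin n) :
    |quadraticWeight X D * X i * X j| ≤ 1 := by
  have h1 := one_le_one_add_sum_abs (X := X)
  rw [mul_assoc, abs_mul, abs_of_pos (quadraticWeight_pos hD), quadraticWeight,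
    inv_mul_le_iff₀ (by positivity), abs_mul, mul_one]
  calc |X i| * |X j| ≤ (1 + ∑ i, |X i|) * (1 + ∑ i, |X i|) :=
        mul_le_mul (abs_le_one_add_sum_abs i) (abs_le_one_add_sum_abs j) (abs_nonneg _) (by linarith)
    _ ≤ (1 + D) * (1 + ∑ i, |X i|) ^ 2 := by
        rw [pow_two]
        exact le_mul_of_one_le_left (by positivity) (by linarith)

/-- The bound must be `(1 + D)⁻¹` and not just `1`: the cut-off `q` can be that small, and a
correction of size `ε (1 + D)⁻¹` still leaves it positive. -/
theorem abs_quadraticWeight_mul_le (hD : 0 ≤ D) (j : Fin n) :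
    |quadraticWeight X D * X j| ≤ (1 + D)⁻¹ := by
  have h1 := one_le_one_add_sum_abs (X := X)
  rw [abs_mul, abs_of_pos (quadraticWeight_pos hD), quadraticWeight, mul_inv, mul_assoc]
  refine mul_le_of_le_one_right (by positivity) ?_
  rw [inv_mul_le_iff₀ (by positivity), mul_one]
  refine (abs_le_one_add_sum_abs j).trans ?_
  rw [pow_two]
  exact le_mul_of_one_le_left (by linarith) h1

theorem quadraticWeight_mul_le (hD : 0 ≤ D) : quadraticWeight X D * D ≤ 1 := by
  have h1 := one_le_one_add_sum_abs (X := X)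
  rw [quadraticWeight, inv_mul_le_iff₀ (by positivity), mul_one]
  calc D ≤ (1 + D) * 1 := by linarith
    _ ≤ _ := by gcongr; exact one_le_pow₀ h1

theorem Measurable.quadraticWeight {Ω : Type*} {F : MeasurableSpace Ω} {X : Ω → Fin n → ℝ}
    {D : Ω → ℝ} (hX : ∀ i, Measurable fun ω => X ω i) (hD : Measurable D) :
    Measurable fun ω => quadraticWeight (X ω) (D ω) := by
  have : Measurable fun ω => ∑ i, |X ω i| :=
    Finset.measurable_sum _ fun i _ => measurable_norm.comp (hX i)
  exact ((hD.const_add 1).mul ((this.const_add 1).pow_const 2)).inv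

end Weight

/-! ### One-period perturbations preserving conditional means. -/

/-- An arbitrarily small positive perturbation `f` of `1`, leaving the conditional mean of `X`
unchanged, which makes the variable `D` conditionally bounded. -/
theorem MeasureTheory.exists_perturbation_condExp_eq {Ω : Type*} {G F m : MeasurableSpace Ω}
    {μ : Measure Ω} [IsFiniteMeasure μ] (hGF : G ≤ F) (hF : F ≤ m) {n : ℕ} {X : Ω → Fin n → ℝ}
    {D : Ω → ℝ} (hX : ∀ i, Measurable[F] fun ω => X ω i)
    (hXi : ∀ i, Integrable (fun ω => X ω i) μ) (hD : Measurable[F] D) (hD0 : ∀ ω, 0 ≤ D ω)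
    {ε : ℝ} (hε : 0 < ε) (hε1 : ε < 1) :
    ∃ f N : Ω → ℝ, Measurable[F] f ∧ Measurable[G] N ∧ (∀ ω, 0 < f ω) ∧ (∀ ω, f ω ≤ 1 + ε) ∧
      μ {ω | f ω < 1 - ε} ≤ ENNReal.ofReal ε ∧ (∀ ω, f ω * D ω ≤ N ω) ∧
      ∀ i, μ[fun ω => f ω * X ω i|G] =ᵐ[μ] μ[fun ω => X ω i|G] := by
  have hG : G ≤ m := hGF.trans hF
  set ψ : Ω → ℝ := fun ω => quadraticWeight (X ω) (D ω) with hψ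
  have hψm : Measurable[F] ψ := Measurable.quadraticWeight hX hD
  have hψpos : ∀ ω, 0 < ψ ω := fun ω => quadraticWeight_pos (hD0 ω)
  have hψX : ∀ i j, Integrable (fun ω => ψ ω * X ω i * X ω j) μ := fun i j =>
    Integrable.of_bound (C := 1)
      (((hψm.mul (hX i)).mul (hX j)).mono hF le_rfl).aestronglyMeasurable
      (ae_of_all _ fun ω => abs_quadraticWeight_mul_mul_le (hD0 ω) i j)
  obtain ⟨B, hBm, hB⟩ := exists_condExp_gram_inverse hG hψpos hψX
  set R : Ω → ℝ := fun ω => ∑ i, |X ω i| with hR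
  have hRi : Integrable R μ := integrable_finsetSum _ fun i _ => (hXi i).abs
  -- With this `c`, the choice of cut-off makes the coefficients `l` below sum to at most `ε` in
  -- absolute value.
  set c : Ω → ℝ := fun ω => ∑ j, ∑ k, |B ω j k| with hc
  have hcm : Measurable[G] c := Finset.measurable_sum _ fun j _ => Finset.measurable_sum _
    fun k _ => measurable_norm.comp (hBm j k)
  obtain ⟨q, N, hqm, hNm, hqD, hq1, hqN, hqμ, hqc⟩ :=
    exists_condExp_cutoff (μ := μ) hGF hF hD hD0 hRi hcm hε
  have hDpos : ∀ ω, 0 < 1 + D ω := fun ω => by linarith [hD0 ω]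
  have hq0 : ∀ ω, 0 < q ω := fun ω => (inv_pos.2 (hDpos ω)).trans_le (hqD ω)
  have hbd : ∀ ω, |1 - q ω| ≤ 1 := fun ω => by
    rw [abs_le]; constructor <;> linarith [hq0 ω, hq1 ω]
  have hqm' : AEStronglyMeasurable (fun ω => 1 - q ω) μ :=
    ((hqm.mono hF le_rfl).const_sub 1).aestronglyMeasurable
  have hint : ∀ i, Integrable (fun ω => (1 - q ω) * X ω i) μ := fun i =>
    (hXi i).bdd_mul hqm' (ae_of_all _ hbd)
  have hintR : Integrable (fun ω => (1 - q ω) * R ω) μ := hRi.bdd_mul hqm' (ae_of_all _ hbd)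
  set e : Fin n → Ω → ℝ := fun k => μ[fun ω => (1 - q ω) * X ω k|G] with he
  have hem : ∀ k, Measurable[G] (e k) := fun k => stronglyMeasurable_condExp.measurable
  -- These solve the normal equations for the mean lost through the cut-off, so `g = ∑ l j ψ X j`
  -- restores it.
  set l : Fin n → Ω → ℝ := fun j ω => ∑ k, B ω j k * e k ω with hl
  have hlm : ∀ j, Measurable[G] (l j) := fun j =>
    Finset.measurable_sum _ fun k _ => (hBm j k).mul (hem k)
  have hsm : MeasurableSet[G] {ω | ∑ j, |l j ω| ≤ ε} :=
    (Finset.measurable_sum _ fun j _ => measurable_norm.comp (hlm j) :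
      Measurable[G] fun ω => ∑ j, |l j ω|) measurableSet_Iic
  -- Almost surely equal to `l`; the truncation makes the bounds on the factor hold everywhere.
  set l' : Fin n → Ω → ℝ := fun j => {ω | ∑ j, |l j ω| ≤ ε}.indicator (l j) with hl'
  have hl'm : ∀ j, Measurable[G] (l' j) := fun j => (hlm j).indicator hsm
  have hl'sum : ∀ ω, ∑ j, |l' j ω| ≤ ε := by
    intro ω
    by_cases h : ∑ j, |l j ω| ≤ ε
    · simpa only [hl', Set.indicator_of_mem (show ω ∈ {ω | ∑ j, |l j ω| ≤ ε} from h)] using h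
    · simpa only [hl', Set.indicator_of_notMem (show ω ∉ {ω | ∑ j, |l j ω| ≤ ε} from h), abs_zero,
        Finset.sum_const_zero] using hε.le
  have hl'bd : ∀ j ω, |l' j ω| ≤ ε := fun j ω =>
    (Finset.single_le_sum (f := fun j => |l' j ω|) (fun k _ => abs_nonneg _)
      (Finset.mem_univ j)).trans (hl'sum ω)
  have hll' : ∀ᵐ ω ∂μ, ∀ j, l' j ω = l j ω := by
    have habs : ∀ᵐ ω ∂μ, ∀ k, |e k ω| ≤ (μ[fun ω => (1 - q ω) * R ω|G]) ω := by
      rw [ae_all_iff]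
      intro k
      refine ae_abs_condExp_le (hint k) hintR fun ω => ?_
      rw [abs_mul, abs_of_nonneg (by linarith [hq1 ω] : 0 ≤ 1 - q ω)]
      refine mul_le_mul_of_nonneg_left ?_ (by linarith [hq1 ω])
      exact Finset.single_le_sum (f := fun k => |X ω k|) (fun k _ => abs_nonneg _)
        (Finset.mem_univ k)
    filter_upwards [habs, hqc] with ω h1 h2 j
    refine Set.indicator_of_mem ?_ _
    refine le_trans ?_ h2
    rw [hc, Finset.sum_mul]
    refine Finset.sum_le_sum fun j _ => ?_
    rw [Finset.sum_mul]
    refine (Finset.abs_sum_le_sum_abs _ _).trans (Finset.sum_le_sum fun k _ => ?_)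
    rw [abs_mul]
    exact mul_le_mul_of_nonneg_left (h1 k) (abs_nonneg _)
  set g : Ω → ℝ := fun ω => ∑ j, l' j ω * (ψ ω * X ω j) with hg
  have hgm : Measurable[F] g := Finset.measurable_sum _ fun j _ =>
    ((hl'm j).mono hGF le_rfl).mul (hψm.mul (hX j))
  have hgbd : ∀ ω, |g ω| ≤ ε * (1 + D ω)⁻¹ := by
    intro ω
    calc |g ω| ≤ ∑ j, |l' j ω| * (1 + D ω)⁻¹ := by
          refine (Finset.abs_sum_le_sum_abs _ _).trans (Finset.sum_le_sum fun j _ => ?_)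
          rw [abs_mul]
          exact mul_le_mul_of_nonneg_left (abs_quadraticWeight_mul_le (hD0 ω) j) (abs_nonneg _)
      _ ≤ ε * (1 + D ω)⁻¹ := by
          rw [← Finset.sum_mul]
          exact mul_le_mul_of_nonneg_right (hl'sum ω) (inv_nonneg.2 (hDpos ω).le)
  have hgq : ∀ ω, |g ω| ≤ ε * q ω := fun ω =>
    (hgbd ω).trans (mul_le_mul_of_nonneg_left (hqD ω) hε.le)
  have hup : ∀ ω, q ω + g ω ≤ (1 + ε) * q ω := fun ω => by linarith [(abs_le.1 (hgq ω)).2]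
  have hlo : ∀ ω, (1 - ε) * q ω ≤ q ω + g ω := fun ω => by linarith [(abs_le.1 (hgq ω)).1]
  refine ⟨fun ω => q ω + g ω, fun ω => (1 + ε) * N ω, hqm.add hgm, Measurable.const_mul hNm _,
    fun ω => (mul_pos (by linarith) (hq0 ω)).trans_le (hlo ω), fun ω => (hup ω).trans ?_, ?_,
    fun ω => ?_, fun i => ?_⟩
  · exact mul_le_of_le_one_right (by linarith) (hq1 ω)
  · refine (measure_mono ?_).trans hqμ
    intro ω (hω : q ω + g ω < 1 - ε)
    by_contra hcon
    have h1 : q ω = 1 := le_antisymm (hq1 ω) (not_lt.1 hcon)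
    have := hlo ω
    rw [h1] at this hω
    linarith
  · calc (q ω + g ω) * D ω ≤ (1 + ε) * q ω * D ω := mul_le_mul_of_nonneg_right (hup ω) (hD0 ω)
      _ ≤ (1 + ε) * (q ω * (1 + D ω)) := by
          rw [mul_assoc]
          refine mul_le_mul_of_nonneg_left ?_ (by linarith)
          exact mul_le_mul_of_nonneg_left (by linarith) (hq0 ω).le
      _ ≤ (1 + ε) * N ω := mul_le_mul_of_nonneg_left (hqN ω) (by linarith)
  · obtain ⟨hS1, hS2⟩ := condExp_sum_mul_of_bound (μ := μ) hG Finset.univ hl'm hl'bd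
      (fun j => hψX i j)
    have hdecomp : (fun ω => (q ω + g ω) * X ω i) = (fun ω => X ω i) -
        (fun ω => (1 - q ω) * X ω i) + fun ω => ∑ j, l' j ω * (ψ ω * X ω i * X ω j) := by
      ext ω
      have : g ω * X ω i = ∑ j, l' j ω * (ψ ω * X ω i * X ω j) := by
        rw [hg, Finset.sum_mul]
        exact Finset.sum_congr rfl fun j _ => by ring
      simp only [Pi.add_apply, Pi.sub_apply]
      rw [← this]; ring
    rw [hdecomp]
    filter_upwards [condExp_add ((hXi i).sub (hint i)) hS1 G, condExp_sub (hXi i) (hint i) G, hS2,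
      hll', hB _ hint i] with ω h1 h2 h3 h4 h5
    rw [h1, Pi.add_apply, h2, h3, Pi.sub_apply]
    have : ∑ j, l' j ω * (μ[fun ω => ψ ω * X ω i * X ω j|G]) ω
        = (μ[fun ω => (1 - q ω) * X ω i|G]) ω := by
      rw [← h5]
      exact Finset.sum_congr rfl fun j _ => by rw [h4 j, mul_comm]
    rw [this]; ring

/-! ### Conditional projection. -/

/-- If `W` is orthogonal to every bounded variable which is conditionally orthogonal to the
variables `X i`, then `W` is a linear combination of them with conditionally deterministic
coefficients. -/
theorem MeasureTheory.exists_eq_sum_mul_of_orthogonal {Ω : Type*} {G F m : MeasurableSpace Ω}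
    {μ : Measure Ω} [IsFiniteMeasure μ] (hGF : G ≤ F) (hF : F ≤ m) {n : ℕ} {X : Ω → Fin n → ℝ}
    {W : Ω → ℝ} (hX : ∀ i, Measurable[F] fun ω => X ω i)
    (hXi : ∀ i, Integrable (fun ω => X ω i) μ) (hW : Measurable[F] W) (hWi : Integrable W μ)
    (horth : ∀ h : Ω → ℝ, Measurable[F] h → (∀ ω, |h ω| ≤ 1 / 2) →
      (∀ i, μ[fun ω => h ω * X ω i|G] =ᵐ[μ] 0) → ∫ ω, h ω * W ω ∂μ = 0) :
    ∃ l : Ω → Fin n → ℝ, (∀ j, Measurable[G] fun ω => l ω j) ∧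
      (∀ᵐ ω ∂μ, W ω = ∑ j, l ω j * X ω j) ∧
      ∀ᵐ ω ∂μ, (μ[W|G]) ω = ∑ j, l ω j * (μ[fun ω => X ω j|G]) ω := by
  have hG : G ≤ m := hGF.trans hF
  -- Taking `D = |W|` makes `ψ W` bounded, so `ψ W X i` is integrable although `W X i` need not be.
  set ψ : Ω → ℝ := fun ω => quadraticWeight (X ω) |W ω| with hψ
  have hψm : Measurable[F] ψ := Measurable.quadraticWeight hX (measurable_norm.comp hW)
  have hψpos : ∀ ω, 0 < ψ ω := fun ω => quadraticWeight_pos (abs_nonneg _)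
  have hψX : ∀ i j, Integrable (fun ω => ψ ω * X ω i * X ω j) μ := fun i j =>
    Integrable.of_bound (C := 1)
      (((hψm.mul (hX i)).mul (hX j)).mono hF le_rfl).aestronglyMeasurable
      (ae_of_all _ fun ω => abs_quadraticWeight_mul_mul_le (abs_nonneg _) i j)
  have hψW1 : ∀ ω, |ψ ω * W ω| ≤ 1 := fun ω => by
    rw [abs_mul, abs_of_pos (hψpos ω)]
    exact quadraticWeight_mul_le (abs_nonneg _)
  have hψX1 : ∀ ω j, |ψ ω * X ω j| ≤ 1 := fun ω j =>
    (abs_quadraticWeight_mul_le (abs_nonneg _) j).trans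
      (inv_le_one_of_one_le₀ (by linarith [abs_nonneg (W ω)]))
  have hψWX : ∀ i, Integrable (fun ω => ψ ω * W ω * X ω i) μ := fun i =>
    (hXi i).bdd_mul ((hψm.mul hW).mono hF le_rfl).aestronglyMeasurable (ae_of_all _ hψW1)
  obtain ⟨B, hBm, hB⟩ := exists_condExp_gram_inverse hG hψpos hψX
  set e : Fin n → Ω → ℝ := fun k => μ[fun ω => ψ ω * W ω * X ω k|G] with he
  have hem : ∀ k, Measurable[G] (e k) := fun k => stronglyMeasurable_condExp.measurable
  set l : Ω → Fin n → ℝ := fun ω j => ∑ k, B ω j k * e k ω with hl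
  have hlm : ∀ j, Measurable[G] fun ω => l ω j := fun j =>
    Finset.measurable_sum _ fun k _ => (hBm j k).mul (hem k)
  set a : Ω → ℝ := fun ω => (1 + ∑ k, |l ω k|)⁻¹ with ha
  have hsum : ∀ ω, 0 ≤ ∑ k, |l ω k| := fun ω => Finset.sum_nonneg fun k _ => abs_nonneg _
  have hapos : ∀ ω, 0 < a ω := fun ω => by
    have := hsum ω
    simp only [ha]; positivity
  have ha1 : ∀ ω, |a ω| ≤ 1 := fun ω => by
    rw [abs_of_pos (hapos ω)]
    exact inv_le_one_of_one_le₀ (by linarith [hsum ω])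
  have ham : Measurable[G] a := by
    have : Measurable[G] fun ω => ∑ k, |l ω k| :=
      Finset.measurable_sum _ fun k _ => measurable_norm.comp (hlm k)
    exact Measurable.inv (Measurable.const_add this 1)
  have halm : ∀ j, Measurable[G] fun ω => a ω * l ω j := fun j => ham.mul (hlm j)
  have hal1 : ∀ j ω, |a ω * l ω j| ≤ 1 := fun j ω => abs_div_one_add_sum_abs_le_one (l ω) j
  have halsum : ∀ ω, ∑ j, |a ω * l ω j| ≤ 1 := fun ω => by
    simp only [abs_mul, ← Finset.mul_sum, abs_of_pos (hapos ω)]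
    rw [ha, inv_mul_le_iff₀ (by linarith [hsum ω])]
    linarith
  -- the conditionally weighted residual
  set h : Ω → ℝ := fun ω => 1 / 2 * (1 / 2 * (a ω * (ψ ω * W ω) -
    ∑ j, a ω * l ω j * (ψ ω * X ω j))) with hh
  have hhm : Measurable[F] h := by
    have h1 : Measurable[F] fun ω => ∑ j, a ω * l ω j * (ψ ω * X ω j) :=
      Finset.measurable_sum _ fun j _ => ((halm j).mono hGF le_rfl).mul (hψm.mul (hX j))
    exact Measurable.const_mul (Measurable.const_mul
      (((ham.mono hGF le_rfl).mul (hψm.mul hW)).sub h1) _) _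
  have hh1 : ∀ ω, |h ω| ≤ 1 / 2 := by
    intro ω
    have h1 : |a ω * (ψ ω * W ω)| ≤ 1 := by
      rw [abs_mul]; exact mul_le_one₀ (ha1 ω) (abs_nonneg _) (hψW1 ω)
    have h2 : |∑ j, a ω * l ω j * (ψ ω * X ω j)| ≤ 1 := by
      refine ((Finset.abs_sum_le_sum_abs _ _).trans (Finset.sum_le_sum fun j _ => ?_)).trans
        (halsum ω)
      rw [abs_mul]
      exact mul_le_of_le_one_right (abs_nonneg _) (hψX1 ω j)
    rw [abs_le] at h1 h2 ⊢
    constructor <;> simp only [hh] <;> linarith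
  have hhX : ∀ i, μ[fun ω => h ω * X ω i|G] =ᵐ[μ] 0 := by
    intro i
    obtain ⟨hS1, hS2⟩ := condExp_sum_mul_of_bound (μ := μ) hG Finset.univ halm hal1
      (fun j => hψX i j)
    obtain ⟨hT1, hT2⟩ := condExp_mul_of_bound (μ := μ) hG ham ha1 (hψWX i)
    have hdecomp : (fun ω => h ω * X ω i) = (1 / 4 : ℝ) • ((fun ω => a ω * (ψ ω * W ω * X ω i)) -
        fun ω => ∑ j, a ω * l ω j * (ψ ω * X ω i * X ω j)) := by
      ext ω
      have : ∑ j, a ω * l ω j * (ψ ω * X ω i * X ω j)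
          = (∑ j, a ω * l ω j * (ψ ω * X ω j)) * X ω i := by
        rw [Finset.sum_mul]
        exact Finset.sum_congr rfl fun j _ => by ring
      simp only [Pi.smul_apply, Pi.sub_apply, smul_eq_mul, this, hh]
      ring
    rw [hdecomp]
    filter_upwards [condExp_smul (μ := μ) (1 / 4 : ℝ) ((fun ω => a ω * (ψ ω * W ω * X ω i)) -
        fun ω => ∑ j, a ω * l ω j * (ψ ω * X ω i * X ω j)) G, condExp_sub hT1 hS1 G, hS2, hT2,
        hB _ hψWX i] with ω h1 h2 h3 h4 h5
    rw [h1, Pi.smul_apply, h2, Pi.sub_apply, h3, h4, ← h5, Finset.mul_sum]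
    rw [← Finset.sum_sub_distrib, Finset.sum_eq_zero, smul_zero, Pi.zero_apply]
    intro j _
    simp only [hl, he]
    ring
  have hhXi : ∀ i, Integrable (fun ω => h ω * X ω i) μ := fun i =>
    (hXi i).bdd_mul (hhm.mono hF le_rfl).aestronglyMeasurable (ae_of_all _ hh1)
  have hW0 : ∫ ω, a ω * h ω * W ω ∂μ = 0 := by
    refine horth (fun ω => a ω * h ω) ((ham.mono hGF le_rfl).mul hhm) (fun ω => ?_) fun i => ?_
    · rw [abs_mul]
      exact (mul_le_of_le_one_left (abs_nonneg _) (ha1 ω)).trans (hh1 ω)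
    · have := (condExp_mul_of_bound (μ := μ) hG ham ha1 (hhXi i)).2
      have h2 : (fun ω => a ω * h ω * X ω i) = fun ω => a ω * (h ω * X ω i) := by
        ext ω; ring
      rw [h2]
      filter_upwards [this, hhX i] with ω h3 h4
      rw [h3, h4, Pi.zero_apply, mul_zero]
  obtain ⟨hL1, hL2⟩ := condExp_sum_mul_of_bound (μ := μ) hG Finset.univ halm hal1 hhXi
  have hX0 : ∫ ω, ∑ j, a ω * l ω j * (h ω * X ω j) ∂μ = 0 := by
    rw [← integral_condExp hG, integral_congr_ae (g := fun _ => (0 : ℝ)) ?_, integral_zero]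
    filter_upwards [hL2, ae_all_iff.2 hhX] with ω h1 h2
    rw [h1]
    exact Finset.sum_eq_zero fun j _ => by rw [h2 j, Pi.zero_apply, mul_zero]
  have hWint : Integrable (fun ω => a ω * h ω * W ω) μ := by
    refine hWi.bdd_mul (c := 1) ((((ham.mono hGF le_rfl).mul hhm).mono hF le_rfl)).aestronglyMeasurable
      (ae_of_all _ fun ω => ?_)
    rw [Real.norm_eq_abs, abs_mul]
    exact mul_le_one₀ (ha1 ω) (abs_nonneg _) ((hh1 ω).trans (by norm_num))
  -- The extra factor `a` bounds the coefficients `a l j`. Since `h` is `a ψ / 4` times the residual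
  -- `W - l · X`, the left side is a positive multiple of the squared residual, with integral zero.
  have hsq : (fun ω => a ω * h ω * W ω - ∑ j, a ω * l ω j * (h ω * X ω j)) =
      fun ω => 1 / 4 * ((a ω) ^ 2 * ψ ω) * (W ω - ∑ j, l ω j * X ω j) ^ 2 := by
    ext ω
    have h1 : ∑ j, a ω * l ω j * (ψ ω * X ω j) = a ω * ψ ω * ∑ j, l ω j * X ω j := by
      rw [Finset.mul_sum]
      exact Finset.sum_congr rfl fun j _ => by ring
    have h2 : ∑ j, a ω * l ω j * (h ω * X ω j) = a ω * h ω * ∑ j, l ω j * X ω j := by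
      rw [Finset.mul_sum]
      exact Finset.sum_congr rfl fun j _ => by ring
    rw [h2]
    simp only [hh, h1]
    ring
  have hres0 := integral_sub hWint hL1
  rw [hW0, hX0, sub_zero, hsq] at hres0
  have hresint := hWint.sub hL1
  change Integrable (fun ω => a ω * h ω * W ω - ∑ j, a ω * l ω j * (h ω * X ω j)) μ at hresint
  rw [hsq] at hresint
  have hcpos : ∀ ω, 0 < 1 / 4 * ((a ω) ^ 2 * ψ ω) := fun ω => by
    have := hapos ω; have := hψpos ω; positivity
  rw [integral_eq_zero_iff_of_nonneg
    (fun ω => mul_nonneg (hcpos ω).le (sq_nonneg _)) hresint] at hres0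
  have hWX : ∀ᵐ ω ∂μ, W ω = ∑ j, l ω j * X ω j := by
    filter_upwards [hres0] with ω h1
    have h2 := (mul_eq_zero.1 h1).resolve_left (hcpos ω).ne'
    exact sub_eq_zero.1 (pow_eq_zero_iff two_ne_zero |>.1 h2)
  refine ⟨l, hlm, hWX, ?_⟩
  -- The `l j` may be unbounded: condition after multiplying by `a`, then cancel `a > 0`.
  have h1 := (condExp_mul_of_bound (μ := μ) hG ham ha1 hWi).2
  have h2 := (condExp_sum_mul_of_bound (μ := μ) hG Finset.univ halm hal1 hXi).2
  have h3 : μ[fun ω => a ω * W ω|G] =ᵐ[μ] μ[fun ω => ∑ j, a ω * l ω j * X ω j|G] := by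
    refine condExp_congr_ae ?_
    filter_upwards [hWX] with ω h
    rw [h, Finset.mul_sum]
    exact Finset.sum_congr rfl fun j _ => by ring
  filter_upwards [h1, h2, h3] with ω h1 h2 h3
  rw [h1, h2] at h3
  refine mul_left_cancel₀ (hapos ω).ne' (h3.trans ?_)
  rw [Finset.mul_sum]
  exact Finset.sum_congr rfl fun j _ => by ring

/-! ### Deflators and their perturbations. -/

theorem MeasureTheory.condExp_apply_pi {Ω ι : Type*} [Fintype ι] {G m : MeasurableSpace Ω}
    {μ : Measure Ω} {f : Ω → ι → ℝ} (hf : Integrable f μ) (i : ι) :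
    (fun ω => (μ[f|G]) ω i) =ᵐ[μ] μ[fun ω => f ω i|G] :=
  (ContinuousLinearMap.proj (R := ℝ) (φ := fun _ : ι => ℝ) i).comp_condExp_comm hf

theorem abs_log_le_two_mul {ε x : ℝ} (hε : ε ≤ 1 / 2) (h1 : 1 - ε ≤ x) (h2 : x ≤ 1 + ε) :
    |Real.log x| ≤ 2 * ε := by
  have hx : 0 < x := by linarith
  have h3 := Real.log_le_sub_one_of_pos hx
  have h4 := Real.one_sub_inv_le_log_of_pos hx
  have h5 : x⁻¹ ≤ 1 + 2 * ε := by
    rw [inv_le_iff_one_le_mul₀ hx]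
    nlinarith
  rw [abs_le]
  constructor <;> linarith

section Deflator

variable {Ω : Type*} {m : MeasurableSpace Ω} {μ : Measure Ω} [IsProbabilityMeasure μ]
  {ℱ : Filtration ℕ m} {n : ℕ} {P : ℕ → Ω → (Fin n → ℝ)} {Y : ℕ → Ω → ℝ}

theorem isMartingaleDeflator_iff (hP : StronglyAdapted ℱ P) :
    IsMartingaleDeflator ℱ μ P Y ↔ (∀ t, Measurable[ℱ t] (Y t)) ∧ (∀ t, ∀ᵐ ω ∂μ, 0 < Y t ω) ∧
      (∀ t i, Integrable (fun ω => Y t ω * P t ω i) μ) ∧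
      ∀ t i, μ[fun ω => Y (t + 1) ω * P (t + 1) ω i|ℱ t] =ᵐ[μ] fun ω => Y t ω * P t ω i := by
  constructor
  · intro h
    refine ⟨fun t => (h.adapted t).measurable, h.pos, fun t i => ?_, fun t i => ?_⟩
    · exact (h.martingale.integrable t).eval i
    · have h1 := h.martingale.2 t (t + 1) t.le_succ
      have h2 := condExp_apply_pi (G := ℱ t) (h.martingale.integrable (t + 1)) i
      filter_upwards [h1, h2] with ω h1 h2
      rw [h1] at h2
      exact h2.symm
  · rintro ⟨h1, h2, h3, h4⟩
    have hint : ∀ t, Integrable (fun ω => Y t ω • P t ω) μ := fun t =>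
      Integrable.of_eval fun i => h3 t i
    refine ⟨fun t => (h1 t).stronglyMeasurable, h2, martingale_nat
      (fun t => (h1 t).stronglyMeasurable.smul (hP t)) hint fun t => ?_⟩
    have h5 : ∀ᵐ ω ∂μ, ∀ i, (μ[fun ω => Y (t + 1) ω • P (t + 1) ω|ℱ t]) ω i
        = (μ[fun ω => Y (t + 1) ω * P (t + 1) ω i|ℱ t]) ω :=
      ae_all_iff.2 fun i => condExp_apply_pi (hint (t + 1)) i
    filter_upwards [h5, ae_all_iff.2 (h4 t)] with ω h5 h6
    ext i
    rw [h5, h6]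
    rfl

theorem measurable_price_apply (hP : StronglyAdapted ℱ P) (t : ℕ) (i : Fin n) :
    Measurable[ℱ t] fun ω => P t ω i :=
  (measurable_pi_apply i).comp (hP t).measurable

/-- Multiplying a deflator from time `T` on by a bounded positive `ℱ T`-measurable variable. -/
theorem IsMartingaleDeflator.mul_from (hP : StronglyAdapted ℱ P)
    (hY : IsMartingaleDeflator ℱ μ P Y) {T : ℕ} {f : Ω → ℝ} {C : ℝ} (hf : Measurable[ℱ T] f)
    (hf0 : ∀ ω, 0 < f ω) (hfC : ∀ ω, f ω ≤ C)
    (hfT : ∀ t, t + 1 = T → ∀ i, μ[fun ω => f ω * (Y T ω * P T ω i)|ℱ t]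
      =ᵐ[μ] μ[fun ω => Y T ω * P T ω i|ℱ t]) :
    IsMartingaleDeflator ℱ μ P (fun s ω => if s < T then Y s ω else f ω * Y s ω) := by
  rw [isMartingaleDeflator_iff hP] at hY ⊢
  obtain ⟨h1, h2, h3, h4⟩ := hY
  have hC : ∀ ω, |f ω| ≤ C := fun ω => by rw [abs_of_pos (hf0 ω)]; exact hfC ω
  refine ⟨fun s => ?_, fun s => ?_, fun s i => ?_, fun s i => ?_⟩
  · by_cases hs : s < T
    · simpa only [hs, if_true] using h1 s
    · simp only [hs, if_false]
      exact (hf.mono (ℱ.mono (not_lt.1 hs)) le_rfl).mul (h1 s)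
  · filter_upwards [h2 s] with ω hω
    split_ifs
    · exact hω
    · exact mul_pos (hf0 ω) hω
  · by_cases hs : s < T
    · simpa only [hs, if_true] using h3 s i
    · simp only [hs, if_false, mul_assoc]
      exact (h3 s i).bdd_mul (hf.mono (ℱ.le T) le_rfl).aestronglyMeasurable (ae_of_all _ hC)
  · by_cases hs : s + 1 < T
    · simpa only [hs, (Nat.lt_succ_self s).trans hs, if_true] using h4 s i
    -- Only the period ending at `T` needs the conditional-mean hypothesis; afterwards `f` is
    -- already known and factors out.
    by_cases hs' : s < T
    · have hT : s + 1 = T := by omega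
      simp only [hs, hs', if_true, if_false, mul_assoc]
      subst hT
      exact (hfT s rfl i).trans (h4 s i)
    · simp only [hs, hs', if_false, mul_assoc]
      have := (condExp_mul_of_bound (μ := μ) (ℱ.le s) (hf.mono (ℱ.mono (not_lt.1 hs')) le_rfl) hC
        (h3 (s + 1) i)).2
      filter_upwards [this, h4 s i] with ω h5 h6
      rw [h5, h6]

/-- A deflator may be perturbed by a factor `F` close to `1` so that a given variable `D`, known at
time `T`, becomes bounded after multiplication by the factor. -/
theorem IsMartingaleDeflator.exists_perturbation (hP : StronglyAdapted ℱ P) (T : ℕ) :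
    ∀ {Y : ℕ → Ω → ℝ}, IsMartingaleDeflator ℱ μ P Y → ∀ {D : Ω → ℝ}, Measurable[ℱ T] D →
      (∀ ω, 0 ≤ D ω) → ∀ {ε : ℝ}, 0 < ε → ε < 1 →
      ∃ (F : ℕ → Ω → ℝ) (C : ℝ), IsMartingaleDeflator ℱ μ P (fun t ω => F t ω * Y t ω) ∧
        (∀ t, Measurable[ℱ t] (F t)) ∧ (∀ t ω, 0 < F t ω) ∧ (∀ t ω, F t ω ≤ 1 + ε) ∧
        (∀ t, μ {ω | F t ω < 1 - ε} ≤ ENNReal.ofReal ε) ∧ (∀ ω, F T ω * D ω ≤ C) ∧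
        ∀ t, T ≤ t → F t = F T := by
  induction T with
  | zero =>
    intro Y hY D hD hD0 ε hε _
    obtain ⟨k, hk⟩ := exists_nat_measure_lt_le (μ := μ) (hD.mono (ℱ.le 0) le_rfl) hε
    set f : Ω → ℝ := fun ω => min 1 (((k : ℝ) + 1) / (1 + D ω)) with hf
    have hDpos : ∀ ω, 0 < 1 + D ω := fun ω => by linarith [hD0 ω]
    have hfm : Measurable[ℱ 0] f :=
      Measurable.min measurable_const (Measurable.div measurable_const (Measurable.const_add hD 1))
    have hf0 : ∀ ω, 0 < f ω := fun ω => lt_min one_pos (div_pos (by positivity) (hDpos ω))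
    have hf1 : ∀ ω, f ω ≤ 1 := fun ω => min_le_left _ _
    refine ⟨fun _ => f, (k : ℝ) + 1, ?_, fun t => hfm.mono (ℱ.mono t.zero_le) le_rfl, fun _ => hf0,
      fun _ ω => (hf1 ω).trans (by linarith), fun _ => ?_, fun ω => ?_, fun _ _ => rfl⟩
    · simpa using hY.mul_from hP hfm hf0 hf1 (fun t ht => by omega)
    · refine (measure_mono ?_).trans hk
      intro ω (hω : f ω < 1 - ε)
      by_contra hcon
      rw [Set.mem_ofPred_eq, not_lt] at hcon
      have : f ω = 1 := by
        refine min_eq_left ?_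
        rw [le_div_iff₀ (hDpos ω)]
        linarith
      linarith
    · calc f ω * D ω ≤ f ω * (1 + D ω) := mul_le_mul_of_nonneg_left (by linarith) (hf0 ω).le
        _ ≤ (k : ℝ) + 1 := by
          rw [← le_div_iff₀ (hDpos ω)]
          exact min_le_right _ _
  | succ T ih =>
    intro Y hY D hD hD0 ε hε hε1
    have hY' := (isMartingaleDeflator_iff hP).1 hY
    -- Here `f D ≤ N` with `N` known at time `T`, so the induction hypothesis applies with `N` as
    -- the new `D`. Tolerance `ε / 3` suffices because `(1 + ε/3)^2 ≤ 1 + ε` and `(1 - ε/3)^2 ≥ 1 -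
    -- ε`.
    obtain ⟨f, N, hfm, hNm, hf0, hf1, hfμ, hfN, hfX⟩ := exists_perturbation_condExp_eq (μ := μ)
      (ℱ.mono T.le_succ) (ℱ.le (T + 1)) (X := fun ω i => Y (T + 1) ω * P (T + 1) ω i)
      (fun i => (hY'.1 (T + 1)).mul (measurable_price_apply hP (T + 1) i)) (hY'.2.2.1 (T + 1))
      hD hD0 (by linarith : 0 < ε / 3) (by linarith : ε / 3 < 1)
    have hY1 := hY.mul_from hP hfm hf0 hf1 (fun t ht i => by
      obtain rfl : t = T := by omega
      exact hfX i)
    obtain ⟨F, C, hF, hFm, hF0, hF1, hFμ, hFC, hFT⟩ := ih hY1 hNm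
      (fun ω => (mul_nonneg (hf0 ω).le (hD0 ω)).trans (hfN ω)) (by linarith : 0 < ε / 3)
      (by linarith : ε / 3 < 1)
    refine ⟨fun s ω => F s ω * if s < T + 1 then 1 else f ω, C, ?_, fun s => ?_, fun s ω => ?_,
      fun s ω => ?_, fun s => ?_, fun ω => ?_, fun s hs => ?_⟩
    · convert hF using 3 with s ω
      simp only [Nat.succ_eq_add_one]
      split_ifs <;> ring
    · by_cases hs : s < T + 1
      · simpa only [hs, if_true, mul_one] using hFm s
      · simp only [hs, if_false]
        exact (hFm s).mul (hfm.mono (ℱ.mono (not_lt.1 hs)) le_rfl)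
    · have := hf0 ω
      have := hF0 s ω
      dsimp only
      split_ifs <;> positivity
    · dsimp only
      split_ifs
      · linarith [hF1 s ω]
      · calc F s ω * f ω ≤ (1 + ε / 3) * (1 + ε / 3) :=
              mul_le_mul (hF1 s ω) (hf1 ω) (hf0 ω).le (by linarith)
          _ ≤ 1 + ε := by nlinarith
    · calc μ {ω | (F s ω * if s < T + 1 then 1 else f ω) < 1 - ε}
          ≤ μ ({ω | F s ω < 1 - ε / 3} ∪ {ω | f ω < 1 - ε / 3}) := by
            refine measure_mono ?_
            intro ω (hω : (F s ω * if s < T + 1 then 1 else f ω) < 1 - ε)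
            by_contra hcon
            rw [Set.mem_union, not_or, Set.mem_ofPred_eq, Set.mem_ofPred_eq, not_lt, not_lt] at hcon
            split_ifs at hω
            · linarith [hcon.1]
            · have := mul_le_mul hcon.1 hcon.2 (by linarith) (hF0 s ω).le
              nlinarith
        _ ≤ ENNReal.ofReal (ε / 3) + ENNReal.ofReal (ε / 3) :=
            (measure_union_le _ _).trans (add_le_add (hFμ s) hfμ)
        _ ≤ ENNReal.ofReal ε := by
            rw [← ENNReal.ofReal_add (by linarith) (by linarith)]
            exact ENNReal.ofReal_le_ofReal (by linarith)
    · dsimp only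
      rw [hFT (T + 1) T.le_succ, if_neg (lt_irrefl _), mul_assoc]
      exact (mul_le_mul_of_nonneg_left (hfN ω) (hF0 T ω).le).trans (hFC ω)
    · ext ω
      dsimp only
      rw [if_neg (not_lt.2 hs), if_neg (lt_irrefl _), hFT s (T.le_succ.trans hs), hFT _ T.le_succ]

/-- The limit of successive perturbations, with summable sizes, of a deflator. -/
theorem IsMartingaleDeflator.mul_exp_tsum_log (hP : StronglyAdapted ℱ P)
    {Z F : ℕ → ℕ → Ω → ℝ} (hZ : ∀ k, IsMartingaleDeflator ℱ μ P (Z k))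
    (hZs : ∀ k t ω, Z (k + 1) t ω = F k t ω * Z k t ω) (hFm : ∀ k t, Measurable[ℱ t] (F k t))
    (hF0 : ∀ k t ω, 0 < F k t ω) (hF1 : ∀ k t ω, F k t ω ≤ 1 + (1 / 2) ^ (k + 1))
    (hFμ : ∀ k t, μ {ω | F k t ω < 1 - (1 / 2) ^ (k + 1)} ≤ ENNReal.ofReal ((1 / 2) ^ (k + 1))) :
    ∃ Y : ℕ → Ω → ℝ, IsMartingaleDeflator ℱ μ P Y ∧
      (∀ t, ∀ᵐ ω ∂μ, Filter.Tendsto (fun k => Z k t ω) Filter.atTop (nhds (Y t ω))) ∧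
      ∀ t j k ω, |Z (j + k) t ω| ≤ Real.exp 1 * |Z j t ω| := by
  have hsum : Summable fun k : ℕ => (1 / 2 : ℝ) ^ (k + 1) :=
    (summable_nat_add_iff 1).2 summable_geometric_two
  have hpart : ∀ k, ∑ j ∈ Finset.range k, (1 / 2 : ℝ) ^ (j + 1) ≤ 1 := by
    intro k
    have : ∑ j ∈ Finset.range k, (1 / 2 : ℝ) ^ (j + 1) = 1 - (1 / 2) ^ k := by
      induction k with
      | zero => simp
      | succ k ih => rw [Finset.sum_range_succ, ih, pow_succ]; ring
    rw [this]
    have : (0 : ℝ) ≤ (1 / 2) ^ k := by positivity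
    linarith
  have hbd : ∀ t j k ω, |Z (j + k) t ω| ≤ Real.exp 1 * |Z j t ω| := by
    intro t j k ω
    have h : |Z (j + k) t ω|
        ≤ Real.exp (∑ i ∈ Finset.range k, (1 / 2 : ℝ) ^ (i + 1)) * |Z j t ω| := by
      induction k with
      | zero => simp
      | succ k ih =>
        rw [← add_assoc, hZs, abs_mul, abs_of_pos (hF0 _ t ω), Finset.sum_range_succ, add_comm (∑ i ∈ _, _),
          Real.exp_add, mul_assoc]
        refine mul_le_mul ((hF1 _ t ω).trans ?_) ih (abs_nonneg _) (Real.exp_pos _).le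
        have h1 : (1 / 2 : ℝ) ^ (j + k + 1) ≤ (1 / 2) ^ (k + 1) :=
          pow_le_pow_of_le_one (by norm_num) (by norm_num) (by omega)
        linarith [Real.add_one_le_exp ((1 / 2 : ℝ) ^ (k + 1))]
    exact h.trans (mul_le_mul_of_nonneg_right (Real.exp_le_exp.2 (hpart k)) (abs_nonneg _))
  have hbd0 : ∀ t k ω, |Z k t ω| ≤ Real.exp 1 * |Z 0 t ω| := fun t k ω => by
    simpa using hbd t 0 k ω
  have hZsum : ∀ k t ω, Z k t ω
      = Real.exp (∑ j ∈ Finset.range k, Real.log (F j t ω)) * Z 0 t ω := by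
    intro k t ω
    induction k with
    | zero => simp
    | succ k ih =>
      rw [hZs, ih, Finset.sum_range_succ, Real.exp_add, Real.exp_log (hF0 k t ω)]
      ring
  -- Borel–Cantelli: almost surely all but finitely many factors lie within `(1 / 2) ^ (k + 1)` of
  -- `1`.
  have hlog : ∀ t, ∀ᵐ ω ∂μ, Summable fun k => Real.log (F k t ω) := by
    intro t
    have hfin : ∑' k, μ {ω | F k t ω < 1 - (1 / 2) ^ (k + 1)} ≠ ⊤ := by
      refine ne_top_of_le_ne_top ?_ (ENNReal.tsum_le_tsum fun k => hFμ k t)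
      exact hsum.tsum_ofReal_ne_top
    filter_upwards [ae_eventually_notMem hfin] with ω hω
    refine Summable.of_norm_bounded_eventually_nat (hsum.mul_left 2) ?_
    filter_upwards [hω] with k hk
    refine abs_log_le_two_mul ?_ (not_lt.1 hk) (hF1 k t ω)
    rw [pow_succ]
    have : (1 / 2 : ℝ) ^ k ≤ 1 := pow_le_one₀ (by norm_num) (by norm_num)
    linarith
  -- Where the series diverges `tsum` is `0`, so the factor stays positive.
  set Y : ℕ → Ω → ℝ := fun t ω => Real.exp (∑' k, Real.log (F k t ω)) * Z 0 t ω with hY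
  have hlim : ∀ t, ∀ᵐ ω ∂μ, Filter.Tendsto (fun k => Z k t ω) Filter.atTop (nhds (Y t ω)) := by
    intro t
    filter_upwards [hlog t] with ω hω
    refine Filter.Tendsto.congr (fun k => (hZsum k t ω).symm) ?_
    exact ((Real.continuous_exp.tendsto _).comp hω.hasSum.tendsto_sum_nat).mul_const _
  have hZ' := fun k => (isMartingaleDeflator_iff hP).1 (hZ k)
  have hYm : ∀ t, Measurable[ℱ t] (Y t) := by
    intro t
    have h1 : Measurable[ℱ t] fun ω => ∑' k, Real.log (F k t ω) :=
      @Measurable.tsum _ _ _ (ℱ t) _ _ _ _ _ _ _ _ _ _ _ _ fun k => Real.measurable_log.comp (hFm k t)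
    exact (Real.measurable_exp.comp h1).mul ((hZ' 0).1 t)
  have hYbd : ∀ t, ∀ᵐ ω ∂μ, |Y t ω| ≤ Real.exp 1 * |Z 0 t ω| := by
    intro t
    filter_upwards [hlim t] with ω hω
    exact le_of_tendsto hω.abs (Filter.Eventually.of_forall fun k => hbd0 t k ω)
  have hbint : ∀ t i, Integrable (fun ω => Real.exp 1 * |Z 0 t ω * P t ω i|) μ := fun t i =>
    (((hZ' 0).2.2.1 t i).abs).const_mul _
  have hYint : ∀ t i, Integrable (fun ω => Y t ω * P t ω i) μ := by
    intro t i
    refine (hbint t i).mono' (((hYm t).mul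
      (measurable_price_apply hP t i)).mono (ℱ.le t) le_rfl).aestronglyMeasurable ?_
    filter_upwards [hYbd t] with ω hω
    rw [Real.norm_eq_abs, abs_mul, abs_mul (Z 0 t ω), ← mul_assoc]
    exact mul_le_mul_of_nonneg_right hω (abs_nonneg _)
  have hZbd : ∀ t i k ω, ‖Z k t ω * P t ω i‖ ≤ Real.exp 1 * |Z 0 t ω * P t ω i| := by
    intro t i k ω
    rw [Real.norm_eq_abs, abs_mul, abs_mul, ← mul_assoc]
    exact mul_le_mul_of_nonneg_right (hbd0 t k ω) (abs_nonneg _)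
  refine ⟨Y, (isMartingaleDeflator_iff hP).2 ⟨hYm, fun t => ?_, hYint, fun t i => ?_⟩, hlim, hbd⟩
  · filter_upwards [(hZ' 0).2.1 t] with ω hω
    exact mul_pos (Real.exp_pos _) hω
  · have hmeas : StronglyMeasurable[ℱ t] fun ω => Y t ω * P t ω i :=
      ((hYm t).mul (measurable_price_apply hP t i)).stronglyMeasurable
    -- Written as its own conditional expectation, the right side fits dominated convergence on both
    -- sides of the martingale identity for `Z k`.
    rw [← condExp_of_stronglyMeasurable (ℱ.le t) hmeas (hYint t i)]
    refine tendsto_condExp_unique (fun k ω => Z k (t + 1) ω * P (t + 1) ω i)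
      (fun k ω => Z k t ω * P t ω i) _ _ (fun k => (hZ' k).2.2.1 (t + 1) i)
      (fun k => (hZ' k).2.2.1 t i) ?_ ?_ _ (hbint (t + 1) i) _ (hbint t i)
      (fun k => ae_of_all _ (hZbd (t + 1) i k)) (fun k => ae_of_all _ (hZbd t i k)) fun k => ?_
    · filter_upwards [hlim (t + 1)] with ω hω using hω.mul_const _
    · filter_upwards [hlim t] with ω hω using hω.mul_const _
    · have hmeas' : StronglyMeasurable[ℱ t] fun ω => Z k t ω * P t ω i :=
        (((hZ' k).1 t).mul (measurable_price_apply hP t i)).stronglyMeasurable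
      rw [condExp_of_stronglyMeasurable (ℱ.le t) hmeas' ((hZ' k).2.2.1 t i)]
      exact (hZ' k).2.2.2 t i

/-- If there is a deflator, then there is one making a given adapted process integrable. -/
theorem exists_isMartingaleDeflator_integrable (hP : StronglyAdapted ℱ P)
    (hY : ∃ Y : ℕ → Ω → ℝ, IsMartingaleDeflator ℱ μ P Y) {ξ : ℕ → Ω → ℝ}
    (hξ : StronglyAdapted ℱ ξ) :
    ∃ Y : ℕ → Ω → ℝ, IsMartingaleDeflator ℱ μ P Y ∧ ∀ t, Integrable (fun ω => ξ t ω * Y t ω) μ := by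
  obtain ⟨Y₀, hY₀⟩ := hY
  have hstep : ∀ (k : ℕ) (Y : {Y : ℕ → Ω → ℝ // IsMartingaleDeflator ℱ μ P Y}), _ := fun k Y =>
    Y.2.exists_perturbation hP k (D := fun ω => |ξ k ω * Y.1 k ω|)
      (measurable_norm.comp ((hξ k).measurable.mul (Y.2.adapted k).measurable))
      (fun ω => abs_nonneg _) (ε := (1 / 2) ^ (k + 1)) (by positivity)
      (pow_lt_one₀ (by norm_num) (by norm_num) (Nat.succ_ne_zero k))
  choose F C hF hFm hF0 hF1 hFμ hFC _ using hstep
  let Z : ℕ → {Y : ℕ → Ω → ℝ // IsMartingaleDeflator ℱ μ P Y} := fun k =>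
    Nat.rec ⟨Y₀, hY₀⟩ (fun k Y => ⟨fun t ω => F k Y t ω * Y.1 t ω, hF k Y⟩) k
  have hZs : ∀ k t ω, (Z (k + 1)).1 t ω = F k (Z k) t ω * (Z k).1 t ω := fun _ _ _ => rfl
  obtain ⟨Y, hY, hlim, hbd⟩ := IsMartingaleDeflator.mul_exp_tsum_log hP (fun k => (Z k).2) hZs
    (fun k => hFm k (Z k)) (fun k => hF0 k (Z k)) (fun k => hF1 k (Z k)) (fun k => hFμ k (Z k))
  refine ⟨Y, hY, fun t => ?_⟩
  -- Perturbation number `t` bounds the deflated value at time `t`; all later ones together enlarge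
  -- it by at most the factor `Real.exp 1`.
  have hsucc : ∀ ω, |ξ t ω * (Z (t + 1)).1 t ω| ≤ C t (Z t) := fun ω => by
    rw [hZs, mul_left_comm, abs_mul, abs_of_pos (hF0 _ _ _ _)]
    exact hFC t (Z t) ω
  refine Integrable.of_bound (C := Real.exp 1 * C t (Z t))
    (((hξ t).measurable.mul (hY.adapted t).measurable).mono (ℱ.le t) le_rfl).aestronglyMeasurable ?_
  filter_upwards [hlim t] with ω hω
  have h1 : Filter.Tendsto (fun k => |ξ t ω * (Z (k + (t + 1))).1 t ω|) Filter.atTop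
      (nhds |ξ t ω * Y t ω|) :=
    ((hω.comp (Filter.tendsto_add_atTop_nat (t + 1))).const_mul _).abs
  refine le_of_tendsto h1 (Filter.Eventually.of_forall fun k => ?_)
  have h2 := hbd t (t + 1) k ω
  have h3 := mul_le_mul_of_nonneg_left h2 (abs_nonneg (ξ t ω))
  rw [add_comm k, abs_mul]
  refine h3.trans ?_
  rw [mul_left_comm, ← abs_mul]
  exact mul_le_mul_of_nonneg_left (hsucc ω) (Real.exp_pos _).le

/-- One-period replication: if `∫ W` does not change when the deflator `Y` is perturbed between
`t` and `t + 1`, then `W` is the deflated terminal value of a portfolio chosen at time `t`. -/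
theorem IsMartingaleDeflator.exists_portfolio (hP : StronglyAdapted ℱ P)
    (hY : IsMartingaleDeflator ℱ μ P Y) (t : ℕ) {W : Ω → ℝ} (hW : Measurable[ℱ (t + 1)] W)
    (hWi : Integrable W μ)
    (hpert : ∀ f : Ω → ℝ, Measurable[ℱ (t + 1)] f → (∀ ω, |f ω| ≤ 3 / 2) →
      IsMartingaleDeflator ℱ μ P (fun s ω => if s < t + 1 then Y s ω else f ω * Y s ω) →
      ∫ ω, f ω * W ω ∂μ = ∫ ω, W ω ∂μ) :
    ∃ l : Ω → Fin n → ℝ, StronglyMeasurable[ℱ t] l ∧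
      (∀ᵐ ω ∂μ, W ω = Y (t + 1) ω * (l ω ⬝ᵥ P (t + 1) ω)) ∧
      ∀ᵐ ω ∂μ, (μ[W|ℱ t]) ω = Y t ω * (l ω ⬝ᵥ P t ω) := by
  obtain ⟨h1, -, h3, h4⟩ := (isMartingaleDeflator_iff hP).1 hY
  obtain ⟨l, hlm, hl1, hl2⟩ := exists_eq_sum_mul_of_orthogonal (μ := μ) (ℱ.mono t.le_succ)
    (ℱ.le (t + 1)) (X := fun ω i => Y (t + 1) ω * P (t + 1) ω i)
    (fun i => (h1 (t + 1)).mul (measurable_price_apply hP (t + 1) i)) (h3 (t + 1)) hW hWi (by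
    intro h hhm hh1 hhX
    have hhi : ∀ {f : Ω → ℝ}, Integrable f μ → Integrable (fun ω => h ω * f ω) μ := fun hf =>
      hf.bdd_mul (hhm.mono (ℱ.le _) le_rfl).aestronglyMeasurable (ae_of_all _ hh1)
    have hfm : Measurable[ℱ (t + 1)] fun ω => 1 + h ω := Measurable.const_add hhm 1
    have hf0 : ∀ ω, 0 < 1 + h ω := fun ω => by linarith [(abs_le.1 (hh1 ω)).1]
    have hf1 : ∀ ω, 1 + h ω ≤ 3 / 2 := fun ω => by linarith [(abs_le.1 (hh1 ω)).2]
    have hdef := hY.mul_from hP hfm hf0 hf1 fun s hs i => by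
      obtain rfl : s = t := by omega
      have h5 := condExp_add (h3 (s + 1) i) (hhi (h3 (s + 1) i)) (ℱ s)
      have h6 : (fun ω => (1 + h ω) * (Y (s + 1) ω * P (s + 1) ω i)) =
          (fun ω => Y (s + 1) ω * P (s + 1) ω i) +
            fun ω => h ω * (Y (s + 1) ω * P (s + 1) ω i) := by
        ext ω; simp only [Pi.add_apply]; ring
      rw [h6]
      filter_upwards [h5, hhX i] with ω h5 h7
      rw [h5, Pi.add_apply, h7, Pi.zero_apply, add_zero]
    have h8 := hpert _ hfm (fun ω => by rw [abs_of_pos (hf0 ω)]; exact hf1 ω) hdef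
    simp only [add_mul, one_mul] at h8
    rw [integral_add hWi (hhi hWi)] at h8
    linarith)
  refine ⟨l, (@measurable_pi_iff _ _ _ (ℱ t) _ _).2 hlm |>.stronglyMeasurable, ?_, ?_⟩
  · filter_upwards [hl1] with ω h
    rw [h, dotProduct, Finset.mul_sum]
    exact Finset.sum_congr rfl fun i _ => by ring
  · filter_upwards [hl2, ae_all_iff.2 (h4 t)] with ω h h'
    rw [h, dotProduct, Finset.mul_sum]
    exact Finset.sum_congr rfl fun i _ => by rw [h']; ring

end Deflator

/-! ### Replication. -/

theorem mainTheorem3 {Ω : Type*} {m : MeasurableSpace Ω} (μ : Measure Ω) [IsProbabilityMeasure μ]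
    (ℱ : Filtration ℕ m) (n : ℕ) (P : ℕ → Ω → (Fin n → ℝ)) (hP : StronglyAdapted ℱ P)
    (hY : ∃ Y : ℕ → Ω → ℝ, IsMartingaleDeflator ℱ μ P Y) :
    (∀ ξ : ℕ → Ω → ℝ, StronglyAdapted ℱ ξ →
      (∀ Y : ℕ → Ω → ℝ, IsMartingaleDeflator ℱ μ P Y →
        (∀ t, Integrable (fun ω => ξ t ω * Y t ω) μ) →
        Martingale (fun t ω => ξ t ω * Y t ω) ℱ μ) →
      ∃ H : ℕ → Ω → (Fin n → ℝ), IsPureInvestmentStrategy ℱ μ P H ∧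
        ∀ t, ∀ᵐ ω ∂μ, H t ω ⬝ᵥ P t ω = ξ t ω) ∧
    (∀ T : ℕ, 0 < T → ∀ ξT : Ω → ℝ, StronglyMeasurable[ℱ T] ξT → ∀ x₀ : ℝ,
      (∀ Y : ℕ → Ω → ℝ, IsMartingaleDeflator ℱ μ P Y →
        Integrable (fun ω => ξT ω * Y T ω) μ →
        ∀ᵐ ω ∂μ, ∫ ω', ξT ω' * Y T ω' ∂μ = x₀ * Y 0 ω) →
      ∃ H : ℕ → Ω → (Fin n → ℝ), IsPureInvestmentStrategy ℱ μ P H ∧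
        ∀ᵐ ω ∂μ, H T ω ⬝ᵥ P T ω = ξT ω) := by
  constructor
  · intro ξ hξ hmart
    obtain ⟨Y, hYd, hYi⟩ := exists_isMartingaleDeflator_integrable hP hY hξ
    have hM := hmart Y hYd hYi
    have hmeas : ∀ t, Measurable[ℱ t] fun ω => ξ t ω * Y t ω := fun t =>
      (hξ t).measurable.mul (hYd.adapted t).measurable
    have hstep : ∀ t, ∃ l : Ω → Fin n → ℝ, StronglyMeasurable[ℱ t] l ∧
        (∀ᵐ ω ∂μ, ξ (t + 1) ω * Y (t + 1) ω = Y (t + 1) ω * (l ω ⬝ᵥ P (t + 1) ω)) ∧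
        ∀ᵐ ω ∂μ, (μ[fun ω => ξ (t + 1) ω * Y (t + 1) ω|ℱ t]) ω = Y t ω * (l ω ⬝ᵥ P t ω) := by
      intro t
      refine hYd.exists_portfolio hP t (hmeas (t + 1)) (hYi (t + 1)) fun f hf hf1 hdef => ?_
      have hM' := hmart _ hdef fun s => ?_
      · have e1 := hM'.2 t (t + 1) t.le_succ
        have e2 := hM.2 t (t + 1) t.le_succ
        simp only [lt_irrefl, Nat.lt_succ_self, if_true, if_false] at e1
        have e3 : (fun ω => f ω * (ξ (t + 1) ω * Y (t + 1) ω))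
            = fun ω => ξ (t + 1) ω * (f ω * Y (t + 1) ω) := by ext ω; ring
        rw [e3, ← integral_condExp (ℱ.le t), integral_congr_ae e1,
          ← integral_congr_ae e2, integral_condExp (ℱ.le t)]
      · by_cases hs : s < t + 1
        · simpa only [hs, if_true] using hYi s
        · simp only [hs, if_false, mul_left_comm (ξ s _)]
          exact (hYi s).bdd_mul (hf.mono (ℱ.le _) le_rfl).aestronglyMeasurable (ae_of_all _ hf1)
    choose l hlm hl1 hl2 using hstep
    have hnext : ∀ t, ∀ᵐ ω ∂μ, l t ω ⬝ᵥ P (t + 1) ω = ξ (t + 1) ω := by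
      intro t
      filter_upwards [hl1 t, hYd.pos (t + 1)] with ω h1 h2
      rw [mul_comm] at h1
      exact (mul_left_cancel₀ h2.ne' h1).symm
    have hcur : ∀ t, ∀ᵐ ω ∂μ, l t ω ⬝ᵥ P t ω = ξ t ω := by
      intro t
      filter_upwards [hl2 t, hYd.pos t, hM.2 t (t + 1) t.le_succ] with ω h1 h2 h3
      rw [h3, mul_comm] at h1
      exact (mul_left_cancel₀ h2.ne' h1).symm
    have hno : ∀ t, 1 ≤ t → ∀ᵐ ω ∂μ, (l (t - 1) ω - l t ω) ⬝ᵥ P t ω = 0 := by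
      intro t ht
      obtain ⟨s, rfl⟩ : ∃ s, t = s + 1 := ⟨t - 1, by omega⟩
      filter_upwards [hnext s, hcur (s + 1)] with ω h1 h2
      rw [Nat.add_sub_cancel, sub_dotProduct, h1, h2, sub_self]
    -- Truncated subtraction gives `H 0 = l 0 = H 1`, the required convention.
    refine ⟨fun t => l (t - 1), ⟨⟨IsStronglyPredictable.of_measurable_add_one (hlm 0) hlm,
      fun t ht => ?_⟩, hno, rfl⟩, fun t => ?_⟩
    · filter_upwards [hno t ht] with ω h
      rw [sub_dotProduct, sub_eq_zero] at h
      exact h.ge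
    · cases t with
      | zero => exact hcur 0
      | succ t => exact hnext t
  · intro T hT ξT hξT x₀ hint
    obtain ⟨Y, hYd, hYi⟩ := exists_isMartingaleDeflator_integrable hP hY
      (ξ := fun t ω => if t = T then ξT ω else 0) fun t => by
        by_cases h : t = T
        · subst h; simpa using hξT
        · simpa only [h, if_false] using stronglyMeasurable_const
    have hVi : Integrable (fun ω => ξT ω * Y T ω) μ := by simpa using hYi T
    set V : ℕ → Ω → ℝ := fun t => μ[fun ω => ξT ω * Y T ω|ℱ t] with hV
    have hVT : V T = fun ω => ξT ω * Y T ω :=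
      condExp_of_stronglyMeasurable (ℱ.le T) (hξT.mul (hYd.adapted T)) hVi
    have hstep : ∀ t, ∃ l : Ω → Fin n → ℝ, t < T → StronglyMeasurable[ℱ t] l ∧
        (∀ᵐ ω ∂μ, V (t + 1) ω = Y (t + 1) ω * (l ω ⬝ᵥ P (t + 1) ω)) ∧
        ∀ᵐ ω ∂μ, V t ω = Y t ω * (l ω ⬝ᵥ P t ω) := by
      intro t
      by_cases ht : t < T
      swap
      · exact ⟨0, fun h => absurd h ht⟩
      obtain ⟨l, h1, h2, h3⟩ := hYd.exists_portfolio hP t (W := V (t + 1))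
        stronglyMeasurable_condExp.measurable integrable_condExp (fun f hf hf1 hdef => by
        have hfV := condExp_mul_of_bound (μ := μ) (ℱ.le (t + 1)) hf hf1 hVi
        rw [← integral_congr_ae hfV.2, integral_condExp (ℱ.le (t + 1)),
          integral_condExp (ℱ.le (t + 1))]
        have hTt : ¬ T < t + 1 := by omega
        -- The perturbation starts at `t + 1 ≥ 1` and leaves `Y 0` unchanged, so both expectations
        -- equal `x₀ * Y 0 ω` at a common `ω`.
        have e1 := hint _ hdef (by
          simp only [hTt, if_false, mul_left_comm (ξT _)]
          exact hfV.1)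
        simp only [hTt, if_false, Nat.succ_pos, if_true, mul_left_comm (ξT _)] at e1
        obtain ⟨ω, h1, h2⟩ := (e1.and (hint Y hYd hVi)).exists
        rw [h1, h2])
      refine ⟨l, fun _ => ⟨h1, h2, ?_⟩⟩
      filter_upwards [h3, condExp_condExp_of_le (μ := μ) (f := fun ω => ξT ω * Y T ω)
        (ℱ.mono t.le_succ) (ℱ.le (t + 1))] with ω h3 h4
      exact h4.symm.trans h3
    choose l hl using hstep
    have hno : ∀ t, 1 ≤ t →
        ∀ᵐ ω ∂μ, (l (min (t - 1) (T - 1)) ω - l (min t (T - 1)) ω) ⬝ᵥ P t ω = 0 := by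
      intro t ht
      obtain ⟨s, rfl⟩ : ∃ s, t = s + 1 := ⟨t - 1, by omega⟩
      by_cases hs : s + 1 < T
      · have e1 : min (s + 1 - 1) (T - 1) = s := by omega
        have e2 : min (s + 1) (T - 1) = s + 1 := by omega
        rw [e1, e2]
        filter_upwards [(hl s (by omega)).2.1, (hl (s + 1) hs).2.2, hYd.pos (s + 1)] with ω h1 h2 h3
        rw [sub_dotProduct, sub_eq_zero]
        exact mul_left_cancel₀ h3.ne' (h1.symm.trans h2)
      · have e1 : min (s + 1 - 1) (T - 1) = min (s + 1) (T - 1) := by omega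
        rw [e1]
        exact ae_of_all _ fun ω => by rw [sub_self, zero_dotProduct]
    have hlm : ∀ t, StronglyMeasurable[ℱ t] (l (min t (T - 1))) := fun t =>
      (hl _ (by omega)).1.mono (ℱ.mono (min_le_left _ _))
    -- The portfolio reached at time `T` is frozen from then on.
    refine ⟨fun t => l (min (t - 1) (T - 1)), ⟨⟨IsStronglyPredictable.of_measurable_add_one
      (hlm 0) hlm, fun t ht => ?_⟩, hno, rfl⟩, ?_⟩
    · filter_upwards [hno t ht] with ω h
      rw [sub_dotProduct, sub_eq_zero] at h
      exact h.ge
    · obtain ⟨s, rfl⟩ : ∃ s, T = s + 1 := ⟨T - 1, by omega⟩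
      simp only [min_self, Nat.add_sub_cancel]
      filter_upwards [(hl s (by omega)).2.1, hYd.pos (s + 1)] with ω h1 h2
      rw [hVT] at h1
      dsimp only at h1
      rw [mul_comm] at h1
      exact (mul_left_cancel₀ h2.ne' h1).symm
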